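/- Let $d$ be an even positive integer, let $\mathcal A$ be a separable unital $C^*$-algebra with an action $\xi$ of $\mathbb Z^d$ by $*$-automorphisms, and let $\mathcal T_{\mathcal A}$ be a continuous, faithful, positive, $\xi$-invariant trace on $\mathcal A$. Let $\mathcal A\rtimes_\xi\mathbb Z^d$ be the crossed product, the enveloping $C^*$-algebra of the $*$-algebra of finite sums $\sum_q a_q\cdot q$ ($a_q\in\mathcal A$, $q\in\mathbb Z^d$) with $(a\cdot p)(b\cdot q)=a\,\xi_{-p}(b)\cdot(p+q)$ and $(a\cdot q)^*=\xi_q(a^*)\cdot(-q)$; let $\Phi_q:\mathcal A\rtimes_\xi\mathbb Z^d\to\mathcal A$ be the Fourier coefficient maps, i.e. the continuous extensions of $\sum_p a_p\cdot p\mapsto a_q$. Put $$(\mathcal A\rtimes_\xi\mathbb Z^d)_{\rm loc}=\Big\{a\in\mathcal A\rtimes_\xi\mathbb Z^d\ :\ \exists\,\alpha\in(0,1),\ \sup_{q}\alpha^{-|q|}\|\Phi_q(a)\|<\infty\Big\}.$$ Let $\mathcal H_{\mathcal A}=\mathcal A\otimes\ell^2(\mathbb Z^d)$ be the standard Hilbert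 $\mathcal A$-module, let $\mathbb K$ and $\mathbb B$ be the compact and the bounded operators on $\ell^2(\mathbb Z^d)$, and let $\mathcal M(\mathcal A\otimes\mathbb K)$ be the $C^*$-algebra of adjointable operators on $\mathcal H_{\mathcal A}$, which contains the spatial tensor product $\mathcal A\otimes\mathbb B$. With $E_{x,y}$ the matrix units of $\ell^2(\mathbb Z^d)$, let $$\hat\pi:\mathcal A\rtimes_\xi\mathbb Z^d\to\mathcal M(\mathcal A\otimes\mathbb K),\qquad \hat\pi(a)=\sum_{x,q}\xi_x(\Phi_q(a))\otimes E_{x,x-q}.$$ Let $\mathcal S_1$ be the linear span of the elements $T=S^*S$, $S\in\mathcal A\otimes\mathbb B$, with $\sum_x\mathcal T_{\mathcal A}(T_{xx})<\infty$. Let $Cl_d$ be the complex Clifford algebra with generators $\gamma_1,\dots,\gamma_d$, $\gamma_i\gamma_j+\gamma_j\gamma_i=2\delta_{ij}$; put $\gamma=\gamma_0\otimes1$ with $\gamma_0=-i^{d/2}\gamma_1\cdots\gamma_d$, put $\hat\pi_\gamma(a)=1\otimes\hat\pi(a)\in Cl_d\otimes\mathcal M(\mathcal A\otimes\mathbb K)$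 and, for $x_0\in[0,1]^d$, $$\mathrm{sign}(\hat d_{x_0})=\sum_{x\in\mathbb Z^d}\gamma\cdot\frac{x+x_0}{|x+x_0|}\otimes1\otimes E_{x,x},\qquad \gamma\cdot v=\sum_i v_i\gamma_i,$$ where, if $x+x_0=0$ for some $x\in\mathbb Z^d$, the undefined unit vector at that $x$ is replaced by an arbitrary fixed unit vector $w\in\mathbb R^d$. **Theorem.** The intrinsic family of Fredholm modules $(Cl_d\otimes\mathcal M(\mathcal A\otimes\mathbb K),\hat\pi_\gamma,\mathrm{sign}(\hat d_{x_0}),\gamma)_{x_0\in[0,1]^d}$ is $n$-summable over $(\mathcal A\rtimes_\xi\mathbb Z^d)_{\rm loc}$ for every $n\ge d+1$: for every $x_0\in[0,1]^d$ and all $a_1,\dots,a_n\in(\mathcal A\rtimes_\xi\mathbb Z^d)_{\rm loc}$, $$\prod_{i=1}^n\big[\mathrm{sign}(\hat d_{x_0}),\hat\pi_\gamma(a_i)\big]\in Cl_d\otimes\mathcal S_1 .$$ -/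

import Mathlib

noncomputable section

namespace Intrinsic

open Filter Topology

section HilbertModule

variable {A : Type*} [CStarAlgebra A] {ι : Type*}

/-- Finite partial sums of the `A`-valued inner product of two families. -/
def partialInner (F : Finset ι) (v w : ι → A) : A := ∑ x ∈ F, star (v x) * w x

theorem partialInner_facts (F : Finset ι) (v w : ι → A) :
    ‖partialInner F v w‖ ≤ √‖partialInner F v v‖ * √‖partialInner F w w‖ ∧
    √‖partialInner F (v + w) (v + w)‖ ≤
      √‖partialInner F v v‖ + √‖partialInner F w w‖ := by
  let _ : PartialOrder A := CStarAlgebra.spectralOrder A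
  have : StarOrderedRing A := CStarAlgebra.spectralOrderedRing A
  let e : (ι → A) → WithCStarModule A (F → A) :=
    fun u => (WithCStarModule.equiv A (F → A)).symm (fun i => star (u i))
  have hin : ∀ u u' : ι → A, inner A (e u) (e u') = partialInner F u' u := by
    intro u u'
    rw [WithCStarModule.pi_inner, partialInner,
      ← Finset.sum_coe_sort F (fun x => star (u' x) * u x)]
    refine Finset.sum_congr rfl fun i _ => ?_
    rw [WithCStarModule.inner_def]
    simp [e]
  have hn : ∀ u : ι → A, ‖e u‖ = √‖partialInner F u u‖ := by
    intro u
    rw [CStarModule.norm_eq_sqrt_norm_inner_self (A := A), hin]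
  constructor
  · rw [← hn v, ← hn w, ← hin w v, mul_comm]
    exact CStarModule.norm_inner_le _
  · have hadd : e (v + w) = e v + e w := by
      ext i
      simp [e]
    rw [← hn v, ← hn w, ← hn (v + w), hadd]
    exact CStarModule.norm_triangle A _ _

theorem norm_partialInner_mono {F F' : Finset ι} (h : F ⊆ F') (v : ι → A) :
    ‖partialInner F v v‖ ≤ ‖partialInner F' v v‖ := by
  let _ : PartialOrder A := CStarAlgebra.spectralOrder A
  have : StarOrderedRing A := CStarAlgebra.spectralOrderedRing A
  refine CStarAlgebra.norm_le_norm_of_nonneg_of_le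
    (Finset.sum_nonneg fun x _ => star_mul_self_nonneg _) ?_
  exact Finset.sum_le_sum_of_subset_of_nonneg h fun x _ _ => star_mul_self_nonneg _

theorem norm_partialInner_mul_le (F : Finset ι) (f v : ι → A) (C : ℝ)
    (hf : ∀ x, ‖f x‖ ≤ C) :
    ‖partialInner F (f * v) (f * v)‖ ≤ C ^ 2 * ‖partialInner F v v‖ := by
  let _ : PartialOrder A := CStarAlgebra.spectralOrder A
  have : StarOrderedRing A := CStarAlgebra.spectralOrderedRing A
  have h : partialInner F (f * v) (f * v) ≤ (C ^ 2 : ℝ) • partialInner F v v := by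
    rw [partialInner, partialInner, Finset.smul_sum]
    refine Finset.sum_le_sum fun x _ => ?_
    have h1 : star ((f * v) x) * (f * v) x = star (v x) * (star (f x) * f x) * v x := by
      simp [mul_assoc]
    rw [h1]
    refine (CStarAlgebra.star_left_conjugate_le_norm_smul (IsSelfAdjoint.star_mul_self _)).trans ?_
    refine smul_le_smul_of_nonneg_right ?_ (star_mul_self_nonneg _)
    rw [CStarRing.norm_star_mul_self, ← sq]
    exact pow_le_pow_left₀ (norm_nonneg _) (hf x) 2
  refine (CStarAlgebra.norm_le_norm_of_nonneg_of_le
    (Finset.sum_nonneg fun x _ => star_mul_self_nonneg _) h).trans ?_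
  rw [norm_smul, Real.norm_of_nonneg (by positivity)]

theorem summable_inner_of {v w : ι → A} (hv : Summable fun x => star (v x) * v x)
    (hw : Summable fun x => star (w x) * w x) : Summable fun x => star (v x) * w x := by
  rw [summable_iff_vanishing_norm] at hv hw ⊢
  intro ε hε
  obtain ⟨s, hs⟩ := hv ε hε
  obtain ⟨t, ht⟩ := hw ε hε
  classical
  refine ⟨s ∪ t, fun F hF => ?_⟩
  have h1 := hs F (hF.mono_right Finset.subset_union_left)
  have h2 := ht F (hF.mono_right Finset.subset_union_right)
  refine ((partialInner_facts F v w).1).trans_lt ?_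
  calc √‖partialInner F v v‖ * √‖partialInner F w w‖ < √ε * √ε :=
        mul_lt_mul'' (Real.sqrt_lt_sqrt (norm_nonneg _) h1) (Real.sqrt_lt_sqrt (norm_nonneg _) h2)
          (Real.sqrt_nonneg _) (Real.sqrt_nonneg _)
    _ = ε := Real.mul_self_sqrt hε.le

variable (A ι)

/-- The square-summable families `(b_x)` in `A`: those for which `∑ b_x* b_x` converges in norm. -/
def sqSummable : Submodule ℂ (ι → A) where
  carrier := {v | Summable fun x => star (v x) * v x}
  zero_mem' := by simp
  add_mem' := by
    intro v w hv hw
    have := ((hv.add hw).add (summable_inner_of hv hw)).add (summable_inner_of hw hv)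
    refine this.congr fun x => ?_
    simp [mul_add, add_mul]
    abel
  smul_mem' := by
    intro c v hv
    refine (Summable.const_smul (star c * c) hv).congr fun x => ?_
    simp [smul_smul, mul_comm]

/-- The standard (right) Hilbert `A`-module `H_A = A ⊗ ℓ²(ι)`. -/
def StdModule : Type _ := ↥(sqSummable A ι)

variable {A ι}

instance : AddCommGroup (StdModule A ι) := inferInstanceAs (AddCommGroup ↥(sqSummable A ι))
instance : Module ℂ (StdModule A ι) := inferInstanceAs (Module ℂ ↥(sqSummable A ι))

namespace StdModule

/-- Constructor from a square-summable family. -/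
def mk (v : ι → A) (hv : Summable fun x => star (v x) * v x) : StdModule A ι := ⟨v, hv⟩

instance : CoeFun (StdModule A ι) (fun _ => ι → A) := ⟨fun v => v.1⟩

@[ext] theorem ext {v w : StdModule A ι} (h : ∀ x, v x = w x) : v = w := Subtype.ext (funext h)

@[simp] theorem mk_apply (v : ι → A) (hv : Summable fun x => star (v x) * v x) (x : ι) :
    mk v hv x = v x := rfl
@[simp] theorem add_apply (v w : StdModule A ι) (x : ι) : (v + w) x = v x + w x := rfl
@[simp] theorem sub_apply (v w : StdModule A ι) (x : ι) : (v - w) x = v x - w x := rfl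
@[simp] theorem zero_apply (x : ι) : (0 : StdModule A ι) x = 0 := rfl
@[simp] theorem smul_apply (c : ℂ) (v : StdModule A ι) (x : ι) : (c • v) x = c • v x := rfl

/-- The `A`-valued inner product `⟨v, w⟩ = ∑ v_x* w_x`, conjugate linear on the left. -/
def ip (v w : StdModule A ι) : A := ∑' x, star (v x) * w x

theorem hasSum_ip (v w : StdModule A ι) : HasSum (fun x => star (v x) * w x) (ip v w) :=
  (summable_inner_of v.2 w.2).hasSum

instance : Norm (StdModule A ι) := ⟨fun v => √‖ip v v‖⟩

theorem norm_def (v : StdModule A ι) : ‖v‖ = √‖ip v v‖ := rfl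

theorem norm_sq (v : StdModule A ι) : ‖v‖ ^ 2 = ‖ip v v‖ := Real.sq_sqrt (norm_nonneg _)

theorem tendsto_partial (v w : StdModule A ι) :
    Tendsto (fun F : Finset ι => partialInner F v w) atTop (𝓝 (ip v w)) := hasSum_ip v w

theorem tendsto_partial_norm (v : StdModule A ι) :
    Tendsto (fun F : Finset ι => √‖partialInner F v v‖) atTop (𝓝 ‖v‖) :=
  (tendsto_partial v v).norm.sqrt

theorem partial_le_norm (v : StdModule A ι) (F : Finset ι) : √‖partialInner F v v‖ ≤ ‖v‖ := by
  refine ge_of_tendsto (tendsto_partial_norm v) ?_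
  filter_upwards [eventually_ge_atTop F] with F' hF'
  exact Real.sqrt_le_sqrt (norm_partialInner_mono hF' _)

theorem norm_le_of_partial (v : StdModule A ι) (C : ℝ)
    (h : ∀ F : Finset ι, √‖partialInner F v v‖ ≤ C) : ‖v‖ ≤ C :=
  le_of_tendsto' (tendsto_partial_norm v) h

theorem norm_apply_le (v : StdModule A ι) (x : ι) : ‖v x‖ ≤ ‖v‖ := by
  have := partial_le_norm v {x}
  rwa [partialInner, Finset.sum_singleton, CStarRing.norm_star_mul_self,
    Real.sqrt_mul_self (norm_nonneg _)] at this

theorem norm_ip_le (v w : StdModule A ι) : ‖ip v w‖ ≤ ‖v‖ * ‖w‖ :=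
  le_of_tendsto_of_tendsto' (tendsto_partial v w).norm
    ((tendsto_partial_norm v).mul (tendsto_partial_norm w)) fun F => (partialInner_facts F v w).1


theorem ip_add_right (u v w : StdModule A ι) : ip u (v + w) = ip u v + ip u w := by
  refine (hasSum_ip u (v + w)).unique ?_
  simpa [mul_add] using (hasSum_ip u v).add (hasSum_ip u w)

theorem ip_smul_right (c : ℂ) (v w : StdModule A ι) : ip v (c • w) = c • ip v w := by
  refine (hasSum_ip v (c • w)).unique ?_
  simpa using (hasSum_ip v w).const_smul c

theorem star_ip (v w : StdModule A ι) : star (ip v w) = ip w v := by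
  refine ((hasSum_ip w v).unique ?_).symm
  simpa using (hasSum_ip v w).star

theorem ip_sub_right (u v w : StdModule A ι) : ip u (v - w) = ip u v - ip u w := by
  refine (hasSum_ip u (v - w)).unique ?_
  simpa [mul_sub] using (hasSum_ip u v).sub (hasSum_ip u w)

theorem ip_add_left (u v w : StdModule A ι) : ip (u + v) w = ip u w + ip v w := by
  rw [← star_ip, ip_add_right, star_add, star_ip, star_ip]

theorem ip_smul_left (c : ℂ) (v w : StdModule A ι) : ip (c • v) w = star c • ip v w := by
  rw [← star_ip, ip_smul_right, star_smul, star_ip]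

theorem eq_of_ip (v w : StdModule A ι) (h : ∀ u, ip u v = ip u w) : v = w := by
  have h0 : ip (v - w) (v - w) = 0 := by rw [ip_sub_right, h, sub_self]
  ext x
  have := norm_apply_le (v - w) x
  rw [norm_def, h0, norm_zero, Real.sqrt_zero] at this
  exact sub_eq_zero.1 (norm_le_zero_iff.1 this)

theorem normCore : NormedSpace.Core ℂ (StdModule A ι) where
  norm_nonneg v := Real.sqrt_nonneg _
  norm_smul c v := by
    rw [norm_def, ip_smul_right, ip_smul_left, norm_smul, norm_smul, norm_star, ← mul_assoc,
      Real.sqrt_mul (by positivity), Real.sqrt_mul_self (norm_nonneg _), norm_def]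
  norm_triangle v w := by
    refine norm_le_of_partial _ _ fun F => ((partialInner_facts F v w).2).trans ?_
    exact add_le_add (partial_le_norm v F) (partial_le_norm w F)
  norm_eq_zero_iff v := by
    constructor
    · intro h
      ext x
      have := norm_apply_le v x
      rw [h] at this
      exact norm_le_zero_iff.1 this
    · rintro rfl
      have h : ip (0 : StdModule A ι) 0 = 0 := by simp [ip]
      rw [norm_def, h, norm_zero, Real.sqrt_zero]

instance : NormedAddCommGroup (StdModule A ι) := NormedAddCommGroup.ofCore normCore
instance : NormedSpace ℂ (StdModule A ι) := NormedSpace.ofCore normCore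

theorem sqrt_partial_sub (F : Finset ι) (v w : ι → A) :
    √‖partialInner F v v‖ ≤ √‖partialInner F (v - w) (v - w)‖ + √‖partialInner F w w‖ := by
  simpa using (partialInner_facts F (v - w) w).2

instance : CompleteSpace (StdModule A ι) := by
  refine Metric.complete_of_cauchySeq_tendsto fun u hu => ?_
  have hc : ∀ x, CauchySeq fun n => u n x := by
    intro x
    rw [Metric.cauchySeq_iff'] at hu ⊢
    intro ε hε
    obtain ⟨N, hN⟩ := hu ε hε
    refine ⟨N, fun n hn => lt_of_le_of_lt ?_ (hN n hn)⟩
    rw [dist_eq_norm, dist_eq_norm]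
    exact norm_apply_le (u n - u N) x
  choose v hv using fun x => cauchySeq_tendsto_of_complete (hc x)
  have key : ∀ ε > 0, ∃ N, ∀ n ≥ N, ∀ F : Finset ι,
      √‖partialInner F (v - (u n).1) (v - (u n).1)‖ ≤ ε := by
    intro ε hε
    obtain ⟨N, hN⟩ := Metric.cauchySeq_iff.1 hu ε hε
    refine ⟨N, fun n hn F => ?_⟩
    have ht : Tendsto (fun m => √‖partialInner F ((u m).1 - (u n).1) ((u m).1 - (u n).1)‖) atTop
        (𝓝 (√‖partialInner F (v - (u n).1) (v - (u n).1)‖)) := by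
      refine (Tendsto.norm ?_).sqrt
      refine tendsto_finsetSum _ fun x _ => ?_
      exact (((hv x).sub_const _).star).mul ((hv x).sub_const _)
    refine le_of_tendsto ht ?_
    filter_upwards [eventually_ge_atTop N] with m hm
    have := hN m hm n hn
    rw [dist_eq_norm] at this
    exact (partial_le_norm (u m - u n) F).trans this.le
  have hmem : Summable fun x => star (v x) * v x := by
    rw [summable_iff_vanishing_norm]
    intro ε hε
    have hδ : 0 < √ε / 2 := by positivity
    obtain ⟨N, hN⟩ := key (√ε / 2) hδ
    obtain ⟨s, hs⟩ := summable_iff_vanishing_norm.1 (u N).2 ((√ε / 2) ^ 2) (by positivity)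
    refine ⟨s, fun F hF => ?_⟩
    have h1 : √‖partialInner F (u N) (u N)‖ < √ε / 2 := by
      rw [Real.sqrt_lt' hδ]; exact hs F hF
    have h2 := (sqrt_partial_sub F v (u N)).trans_lt (add_lt_add_of_le_of_lt (hN N le_rfl F) h1)
    rw [add_halves] at h2
    exact (Real.sqrt_lt_sqrt_iff (norm_nonneg _)).1 h2
  refine ⟨mk v hmem, ?_⟩
  rw [Metric.tendsto_atTop]
  intro ε hε
  obtain ⟨N, hN⟩ := key (ε / 2) (half_pos hε)
  refine ⟨N, fun n hn => ?_⟩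
  rw [dist_comm, dist_eq_norm]
  refine lt_of_le_of_lt (norm_le_of_partial _ (ε / 2) fun F => ?_) (half_lt_self hε)
  exact hN n hn F

theorem tendsto_ip_right {α : Type*} {l : Filter α} (v : StdModule A ι) {f : α → StdModule A ι}
    {w : StdModule A ι} (h : Tendsto f l (𝓝 w)) :
    Tendsto (fun n => ip v (f n)) l (𝓝 (ip v w)) := by
  rw [tendsto_iff_norm_sub_tendsto_zero] at h ⊢
  refine squeeze_zero (fun _ => norm_nonneg _) (fun n => ?_) (by simpa using h.const_mul ‖v‖)
  rw [← ip_sub_right]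
  exact norm_ip_le _ _

theorem tendsto_ip_left {α : Type*} {l : Filter α} {f : α → StdModule A ι}
    {v : StdModule A ι} (h : Tendsto f l (𝓝 v)) (w : StdModule A ι) :
    Tendsto (fun n => ip (f n) w) l (𝓝 (ip v w)) := by
  simpa only [star_ip] using (tendsto_ip_right w h).star

open Classical in
/-- The element `a ⊗ δ_y` of the standard module. -/
def single (y : ι) (a : A) : StdModule A ι :=
  ⟨Pi.single y a, (hasSum_single y fun x hx => by simp [Pi.single_eq_of_ne hx]).summable⟩

@[simp] theorem single_same (y : ι) (a : A) : single y a y = a := by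
  classical
  simp [single]

theorem single_ne {x y : ι} (h : x ≠ y) (a : A) : single y a x = 0 := by
  classical
  simp [single, h]

theorem ip_single_left (y : ι) (a : A) (v : StdModule A ι) : ip (single y a) v = star a * v y := by
  refine (hasSum_ip _ _).unique ?_
  have := hasSum_single (f := fun x => star (single y a x) * v x) y
    fun x hx => by simp [single_ne hx]
  simpa using this

theorem norm_single_le (y : ι) (a : A) : ‖single y a‖ ≤ ‖a‖ := by
  rw [norm_def, ip_single_left, single_same, CStarRing.norm_star_mul_self,
    Real.sqrt_mul_self (norm_nonneg _)]

end StdModule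

open StdModule

/-- `S` is an adjoint of `T`. -/
def IsAdjointOf (S T : StdModule A ι →L[ℂ] StdModule A ι) : Prop :=
  ∀ v w, ip (T v) w = ip v (S w)

theorem IsAdjointOf.symm {S T : StdModule A ι →L[ℂ] StdModule A ι} (h : IsAdjointOf S T) :
    IsAdjointOf T S := fun v w => by rw [← star_ip, ← h w v, star_ip]

theorem IsAdjointOf.unique {S S' T : StdModule A ι →L[ℂ] StdModule A ι} (h : IsAdjointOf S T)
    (h' : IsAdjointOf S' T) : S = S' := by
  ext1 w
  exact eq_of_ip _ _ fun u => by rw [← h, ← h']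

variable (A ι)

/-- The algebra of adjointable operators on `H_A`, i.e. the multiplier algebra `M(A ⊗ K)`. -/
def adjointable : Subalgebra ℂ (StdModule A ι →L[ℂ] StdModule A ι) where
  carrier := {T | ∃ S, IsAdjointOf S T}
  mul_mem' := by
    rintro T T' ⟨S, hS⟩ ⟨S', hS'⟩
    exact ⟨S' * S, fun v w => by simp [hS _ _, hS' _ _]⟩
  add_mem' := by
    rintro T T' ⟨S, hS⟩ ⟨S', hS'⟩
    exact ⟨S + S', fun v w => by simp [ip_add_left, ip_add_right, hS _ _, hS' _ _]⟩
  algebraMap_mem' c := ⟨algebraMap ℂ _ (star c), fun v w => by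
    simp [Algebra.algebraMap_eq_smul_one, ip_smul_left, ip_smul_right]⟩

/-- The C*-algebra `M(A ⊗ K)` of adjointable operators on `H_A`. -/
def MultAlg : Type _ := ↥(adjointable A ι)

variable {A ι}

instance : NormedRing (MultAlg A ι) := inferInstanceAs (NormedRing ↥(adjointable A ι))
instance : NormedAlgebra ℂ (MultAlg A ι) :=
  inferInstanceAs (NormedAlgebra ℂ ↥(adjointable A ι))

namespace MultAlg

@[simp] theorem coe_add (T S : MultAlg A ι) : (T + S).1 = T.1 + S.1 := rfl
@[simp] theorem coe_mul (T S : MultAlg A ι) : (T * S).1 = T.1 * S.1 := rfl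
@[simp] theorem coe_one : (1 : MultAlg A ι).1 = 1 := rfl
@[simp] theorem coe_smul (c : ℂ) (T : MultAlg A ι) : (c • T).1 = c • T.1 := rfl
theorem norm_def (T : MultAlg A ι) : ‖T‖ = ‖T.1‖ := rfl

instance : Star (MultAlg A ι) := ⟨fun T => ⟨T.2.choose, T.1, T.2.choose_spec.symm⟩⟩

theorem isAdjointOf_star (T : MultAlg A ι) : IsAdjointOf (star T).1 T.1 := T.2.choose_spec

theorem star_eq {T S : MultAlg A ι} (h : IsAdjointOf S.1 T.1) : star T = S :=
  Subtype.ext ((isAdjointOf_star T).unique h)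

instance : StarRing (MultAlg A ι) where
  star_involutive T := star_eq (isAdjointOf_star T).symm
  star_mul T S := star_eq fun v w => by
    simp [isAdjointOf_star T _ _, isAdjointOf_star S _ _]
  star_add T S := star_eq fun v w => by
    simp [ip_add_left, ip_add_right, isAdjointOf_star T _ _, isAdjointOf_star S _ _]

instance : StarModule ℂ (MultAlg A ι) where
  star_smul c T := star_eq fun v w => by
    simp [ip_smul_left, ip_smul_right, isAdjointOf_star T _ _]

instance : CStarRing (MultAlg A ι) where
  norm_mul_self_le T := by
    have h : ‖T.1‖ ≤ √‖star T * T‖ := by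
      refine T.1.opNorm_le_bound (Real.sqrt_nonneg _) fun v => ?_
      have h1 : ‖T.1 v‖ ^ 2 ≤ ‖star T * T‖ * ‖v‖ ^ 2 := by
        rw [norm_sq, isAdjointOf_star T]
        refine (norm_ip_le _ _).trans ?_
        have h2 := (star T * T).1.le_opNorm v
        calc ‖v‖ * ‖(star T).1 (T.1 v)‖ ≤ ‖v‖ * (‖(star T * T).1‖ * ‖v‖) := by
              gcongr; exact h2
          _ = ‖star T * T‖ * ‖v‖ ^ 2 := by
              change _ = ‖(star T * T).1‖ * _; ring
      rw [← Real.sqrt_sq (norm_nonneg v), ← Real.sqrt_mul (norm_nonneg (star T * T))]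
      exact Real.le_sqrt_of_sq_le h1
    calc ‖T‖ * ‖T‖ ≤ √‖star T * T‖ * √‖star T * T‖ := by gcongr <;> exact h
      _ = ‖star T * T‖ := Real.mul_self_sqrt (norm_nonneg _)

instance : CompleteSpace (MultAlg A ι) := by
  refine Metric.complete_of_cauchySeq_tendsto fun u hu => ?_
  have h1 : CauchySeq fun n => (u n).1 := hu.map uniformContinuous_subtype_val
  have h2 : CauchySeq fun n => (star (u n)).1 := by
    rw [Metric.cauchySeq_iff'] at hu ⊢
    intro ε hε
    obtain ⟨N, hN⟩ := hu ε hε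
    refine ⟨N, fun n hn => ?_⟩
    have := hN n hn
    rw [dist_eq_norm, ← norm_star, star_sub] at this
    rw [dist_eq_norm]
    exact this
  obtain ⟨T, hT⟩ := cauchySeq_tendsto_of_complete h1
  obtain ⟨S, hS⟩ := cauchySeq_tendsto_of_complete h2
  have hadj : IsAdjointOf S T := by
    intro v w
    have e1 : Tendsto (fun n => ip ((u n).1 v) w) atTop (𝓝 (ip (T v) w)) :=
      tendsto_ip_left (((ContinuousLinearMap.apply ℂ _ v).continuous.tendsto T).comp hT) w
    have e2 : Tendsto (fun n => ip v ((star (u n)).1 w)) atTop (𝓝 (ip v (S w))) :=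
      tendsto_ip_right v (((ContinuousLinearMap.apply ℂ _ w).continuous.tendsto S).comp hS)
    exact tendsto_nhds_unique e1 (e2.congr fun n => (isAdjointOf_star (u n) v w).symm)
  exact ⟨⟨T, S, hadj⟩, tendsto_subtype_rng.2 hT⟩

instance : CStarAlgebra (MultAlg A ι) where

/-- Matrix entry: `T = ∑ T_xy ⊗ E_xy`. -/
def entry (T : MultAlg A ι) (x y : ι) : A := T.1 (single y 1) x

theorem norm_entry_le (T : MultAlg A ι) (x y : ι) : ‖entry T x y‖ ≤ ‖T‖ := by
  have h1 : ‖single y (1 : A)‖ ≤ 1 := by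
    refine (norm_single_le y (1 : A)).trans ?_
    rcases subsingleton_or_nontrivial A with h | h
    · rw [Subsingleton.elim (1 : A) 0, norm_zero]; exact zero_le_one
    · exact CStarRing.norm_one.le
  calc ‖entry T x y‖ ≤ ‖T.1 (single y 1)‖ := norm_apply_le _ x
    _ ≤ ‖T.1‖ * ‖single y (1 : A)‖ := T.1.le_opNorm _
    _ ≤ ‖T.1‖ * 1 := by gcongr
    _ = ‖T‖ := mul_one _

theorem entry_add (T S : MultAlg A ι) (x y : ι) : entry (T + S) x y = entry T x y + entry S x y :=
  rfl

theorem entry_smul (c : ℂ) (T : MultAlg A ι) (x y : ι) : entry (c • T) x y = c • entry T x y :=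
  rfl

theorem isSq_mul (f v : ι → A) (C : ℝ) (hf : ∀ x, ‖f x‖ ≤ C)
    (hv : Summable fun x => star (v x) * v x) :
    Summable fun x => star ((f * v) x) * (f * v) x := by
  rw [summable_iff_vanishing_norm] at hv ⊢
  intro ε hε
  obtain ⟨s, hs⟩ := hv (ε / (C ^ 2 + 1)) (by positivity)
  refine ⟨s, fun F hF => ?_⟩
  have h1 : ‖partialInner F v v‖ < ε / (C ^ 2 + 1) := hs F hF
  rw [lt_div_iff₀ (by positivity)] at h1
  refine (norm_partialInner_mul_le F f v C hf).trans_lt ?_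
  nlinarith [norm_nonneg (partialInner F v v)]

/-- The bounded operator `(v_x) ↦ (f_x v_x)` for a bounded family `f` (and `0` otherwise). -/
def diagCLM (f : ι → A) (C : ℝ) (hf : ∀ x, ‖f x‖ ≤ C) : StdModule A ι →L[ℂ] StdModule A ι :=
  LinearMap.mkContinuous
    { toFun := fun v => mk (f * v.1) (isSq_mul f v.1 C hf v.2)
      map_add' := fun v w => by ext x; simp [mul_add]
      map_smul' := fun c v => by ext x; simp } |C| fun v => by
    refine norm_le_of_partial _ _ fun F => ?_
    refine (Real.sqrt_le_sqrt (norm_partialInner_mul_le F f v.1 C hf)).trans ?_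
    rw [Real.sqrt_mul (sq_nonneg _), Real.sqrt_sq_eq_abs]
    gcongr
    exact partial_le_norm v F

@[simp] theorem diagCLM_apply (f : ι → A) (C : ℝ) (hf : ∀ x, ‖f x‖ ≤ C) (v : StdModule A ι)
    (x : ι) : diagCLM f C hf v x = f x * v x := rfl

theorem isAdjointOf_diagCLM (f g : ι → A) (C : ℝ) (hf : ∀ x, ‖f x‖ ≤ C) (hg : ∀ x, ‖g x‖ ≤ C)
    (h : ∀ x, star (f x) = g x) : IsAdjointOf (diagCLM g C hg) (diagCLM f C hf) := fun v w => by
  refine tsum_congr fun x => ?_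
  simp [h, mul_assoc]

theorem norm_diagCLM_le (f : ι → A) (C : ℝ) (hf : ∀ x, ‖f x‖ ≤ C) : ‖diagCLM f C hf‖ ≤ |C| :=
  LinearMap.mkContinuous_norm_le _ (abs_nonneg C) _

/-- The diagonal element `∑_x f_x ⊗ E_xx` of a bounded family `f`. -/
def diag (f : ι → A) (hf : ∃ C, ∀ x, ‖f x‖ ≤ C) : MultAlg A ι :=
  ⟨diagCLM f hf.choose hf.choose_spec, diagCLM (fun x => star (f x)) hf.choose
    (fun x => by rw [norm_star]; exact hf.choose_spec x), isAdjointOf_diagCLM _ _ _ _ _ fun _ => rfl⟩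

@[simp] theorem diag_apply (f : ι → A) (hf : ∃ C, ∀ x, ‖f x‖ ≤ C) (v : StdModule A ι) (x : ι) :
    (diag f hf).1 v x = f x * v x := rfl

theorem ext_apply {T S : MultAlg A ι} (h : ∀ v x, T.1 v x = S.1 v x) : T = S :=
  Subtype.ext (ContinuousLinearMap.ext fun v => StdModule.ext (h v))

theorem star_diag (f : ι → A) (hf : ∃ C, ∀ x, ‖f x‖ ≤ C)
    (hf' : ∃ C, ∀ x, ‖(fun x => star (f x)) x‖ ≤ C) :
    star (diag f hf) = diag (fun x => star (f x)) hf' := by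
  refine star_eq fun v w => tsum_congr fun x => ?_
  simp [mul_assoc]

theorem summable_perm (e : Equiv.Perm ι) (v : StdModule A ι) :
    Summable fun x => star ((v.1 ∘ e) x) * (v.1 ∘ e) x :=
  (e.summable_iff (f := fun x => star (v.1 x) * v.1 x)).2 v.2

theorem ip_perm (e : Equiv.Perm ι) (v w : StdModule A ι) :
    ∑' x, star (v.1 (e x)) * w.1 (e x) = ip v w :=
  e.tsum_eq (fun x => star (v.1 x) * w.1 x)

/-- The bounded operator `(v_x) ↦ (v_{e x})`. -/
def permCLM (e : Equiv.Perm ι) : StdModule A ι →L[ℂ] StdModule A ι :=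
  LinearMap.mkContinuous
    { toFun := fun v => mk (v.1 ∘ e) (summable_perm e v)
      map_add' := fun v w => rfl
      map_smul' := fun c v => rfl } 1 fun v => by
    rw [one_mul]
    exact (congrArg (fun a => √‖a‖) (ip_perm e v v)).le

@[simp] theorem permCLM_apply (e : Equiv.Perm ι) (v : StdModule A ι) (x : ι) :
    permCLM e v x = v (e x) := rfl

theorem norm_permCLM_le (e : Equiv.Perm ι) : ‖permCLM (A := A) e‖ ≤ 1 :=
  LinearMap.mkContinuous_norm_le _ zero_le_one _

theorem isAdjointOf_permCLM (e : Equiv.Perm ι) :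
    IsAdjointOf (permCLM (A := A) e.symm) (permCLM e) := fun v w => by
  rw [← ip_perm e v]
  simp [ip]

/-- The unitary `(v_x) ↦ (v_{e x})`. -/
def perm (e : Equiv.Perm ι) : MultAlg A ι := ⟨permCLM e, _, isAdjointOf_permCLM e⟩

@[simp] theorem perm_apply (e : Equiv.Perm ι) (v : StdModule A ι) (x : ι) :
    (perm e : MultAlg A ι).1 v x = v (e x) := rfl

theorem star_perm (e : Equiv.Perm ι) : star (perm e : MultAlg A ι) = perm e.symm :=
  star_eq (isAdjointOf_permCLM e)

end MultAlg

end HilbertModule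

section CrossedProduct

open MultAlg

variable {A : Type*} [CStarAlgebra A] {d : ℕ}

/-- An action of `ℤ^d` on `A` by *-automorphisms. -/
abbrev LatticeAction (d : ℕ) (A : Type*) [CStarAlgebra A] : Type _ :=
  Multiplicative (Fin d → ℤ) →* (A ≃⋆ₐ[ℂ] A)

/-- The automorphism `ξ_x`. -/
def LatticeAction.aut (ξ : LatticeAction d A) (x : Fin d → ℤ) : A ≃⋆ₐ[ℂ] A :=
  ξ (Multiplicative.ofAdd x)

theorem LatticeAction.aut_add (ξ : LatticeAction d A) (x y : Fin d → ℤ) (a : A) :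
    ξ.aut (x + y) a = ξ.aut x (ξ.aut y a) := by
  simp [LatticeAction.aut, ofAdd_add]

theorem LatticeAction.aut_zero (ξ : LatticeAction d A) (a : A) : ξ.aut 0 a = a := by
  simp [LatticeAction.aut]

/-- The action `q • a = ξ_{-q}(a)` used to twist the product of the core algebra. -/
abbrev LatticeAction.toMulSemiringAction (ξ : LatticeAction d A) :
    MulSemiringAction (Multiplicative (Fin d → ℤ)) A where
  smul q a := ξ.aut (-q.toAdd) a
  one_smul a := by
    change ξ.aut (-0) a = a
    rw [neg_zero, ξ.aut_zero]
  mul_smul p q a := by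
    change ξ.aut (-(p.toAdd + q.toAdd)) a = ξ.aut _ (ξ.aut _ a)
    rw [neg_add, ξ.aut_add]
  smul_zero q := map_zero _
  smul_add q := map_add _
  smul_one q := map_one _
  smul_mul q := map_mul _

/-- The core algebra `Aℤ^d` of finite sums `∑ a_q · q`, with `q · a = ξ_{-q}(a) · q`. -/
def Core (_ξ : LatticeAction d A) : Type _ := SkewMonoidAlgebra A (Multiplicative (Fin d → ℤ))

namespace Core

variable (ξ : LatticeAction d A)

instance : Ring (Core ξ) :=
  letI := ξ.toMulSemiringAction
  inferInstanceAs (Ring (SkewMonoidAlgebra A (Multiplicative (Fin d → ℤ))))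

instance : Module ℂ (Core ξ) :=
  inferInstanceAs (Module ℂ (SkewMonoidAlgebra A (Multiplicative (Fin d → ℤ))))

variable {ξ}

/-- The coefficient `a_q` of `∑ a_q · q`. -/
def coeff (a : Core ξ) (q : Fin d → ℤ) : A := SkewMonoidAlgebra.coeff a (Multiplicative.ofAdd q)

/-- The monomial `a · q`. -/
def mono (ξ : LatticeAction d A) (q : Fin d → ℤ) (a : A) : Core ξ :=
  SkewMonoidAlgebra.single (Multiplicative.ofAdd q) a

theorem induct {P : Core ξ → Prop} (f : Core ξ) (h0 : P 0) (hm : ∀ q a, P (mono ξ q a))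
    (ha : ∀ f g, P f → P g → P (f + g)) : P f :=
  SkewMonoidAlgebra.induction_on f h0 (fun q a => hm q.toAdd a) (fun {f g} => ha f g)

theorem mono_add (q : Fin d → ℤ) (a b : A) : mono ξ q (a + b) = mono ξ q a + mono ξ q b :=
  SkewMonoidAlgebra.single_add _ _ _

theorem mono_zero (q : Fin d → ℤ) : mono ξ q 0 = 0 := SkewMonoidAlgebra.single_zero _

theorem mono_mul (p q : Fin d → ℤ) (a b : A) :
    mono ξ p a * mono ξ q b = mono ξ (p + q) (a * ξ.aut (-p) b) :=
  letI := ξ.toMulSemiringAction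
  SkewMonoidAlgebra.single_mul_single

theorem mono_smul (c : ℂ) (q : Fin d → ℤ) (a : A) : c • mono ξ q a = mono ξ q (c • a) :=
  SkewMonoidAlgebra.smul_single _ _ _

theorem one_def : (1 : Core ξ) = mono ξ 0 1 := rfl

@[simp] theorem coeff_add (f g : Core ξ) (q : Fin d → ℤ) :
    coeff (f + g) q = coeff f q + coeff g q :=
  congrArg (fun h => h (Multiplicative.ofAdd q)) (SkewMonoidAlgebra.coeff_add f g)

theorem coeff_smul (c : ℂ) (f : Core ξ) (q : Fin d → ℤ) : coeff (c • f) q = c • coeff f q :=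
  congrArg (fun h => h (Multiplicative.ofAdd q)) (SkewMonoidAlgebra.coeff_smul c f)

theorem coeff_zero (q : Fin d → ℤ) : coeff (0 : Core ξ) q = 0 := rfl

theorem coeff_mono (p q : Fin d → ℤ) (a : A) : coeff (mono ξ p a) q = if p = q then a else 0 := by
  classical
  simp [coeff, mono, Finsupp.single_apply]

instance : Algebra ℂ (Core ξ) :=
  Algebra.ofModule
    (fun c f g => by
      induction f using induct with
      | h0 => simp
      | hm p a =>
        induction g using induct with
        | h0 => simp
        | hm q b => simp only [mono_smul, mono_mul, smul_mul_assoc]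
        | ha f g hf hg => rw [mul_add, hf, hg, mul_add, smul_add]
      | ha f f' hf hf' => rw [smul_add, add_mul, hf, hf', add_mul, smul_add])
    (fun c f g => by
      induction f using induct with
      | h0 => simp
      | hm p a =>
        induction g using induct with
        | h0 => simp
        | hm q b => simp only [mono_smul, mono_mul, map_smul, mul_smul_comm]
        | ha f g hf hg => rw [smul_add, mul_add, hf, hg, mul_add, smul_add]
      | ha f f' hf hf' => rw [add_mul, hf, hf', add_mul, smul_add])

/-- Additive maps out of the core are determined by monomials. -/
def lift {N : Type*} [AddCommMonoid N] (f : (Fin d → ℤ) → A →+ N) : Core ξ →+ N where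
  toFun g := SkewMonoidAlgebra.sum g fun q b => f q.toAdd b
  map_zero' := SkewMonoidAlgebra.sum_zero_index
  map_add' _ _ := SkewMonoidAlgebra.sum_add_index' (fun _ => map_zero _) (fun _ => map_add _)

theorem lift_mono {N : Type*} [AddCommMonoid N] (f : (Fin d → ℤ) → A →+ N) (q : Fin d → ℤ) (a : A) :
    lift f (mono ξ q a) = f q a :=
  SkewMonoidAlgebra.sum_single_index (map_zero _)

theorem addHom_ext {N : Type*} [AddZeroClass N] {f g : Core ξ →+ N}
    (h : ∀ q a, f (mono ξ q a) = g (mono ξ q a)) : f = g :=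
  SkewMonoidAlgebra.addHom_ext fun q a => h q.toAdd a

/-- `(a · q)^* = q^{-1} · a^* = ξ_q(a^*) · (-q)`. -/
def starHom (ξ : LatticeAction d A) : Core ξ →+ Core ξ :=
  lift fun q => AddMonoidHom.mk' (fun a => mono ξ (-q) (ξ.aut q (star a))) fun a b => by
    rw [star_add, map_add, mono_add]

instance : Star (Core ξ) := ⟨starHom ξ⟩

theorem star_mono (q : Fin d → ℤ) (a : A) :
    star (mono ξ q a) = mono ξ (-q) (ξ.aut q (star a)) := lift_mono _ _ _

theorem star_add' (f g : Core ξ) : star (f + g) = star f + star g := map_add (starHom ξ) f g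

theorem star_zero' : star (0 : Core ξ) = 0 := map_zero (starHom ξ)

instance : StarRing (Core ξ) where
  star_involutive f := by
    induction f using induct with
    | h0 => rw [star_zero', star_zero']
    | hm q a =>
      rw [star_mono, star_mono, neg_neg, ← map_star, star_star, ← ξ.aut_add, neg_add_cancel,
        ξ.aut_zero]
    | ha f g hf hg => rw [star_add', star_add', hf, hg]
  star_mul f g := by
    induction f using induct with
    | h0 => rw [zero_mul, star_zero', mul_zero]
    | hm p a =>
      induction g using induct with
      | h0 => rw [mul_zero, star_zero', zero_mul]
      | hm q b =>
        rw [mono_mul, star_mono, star_mono, star_mono, mono_mul, star_mul, map_mul, ← map_star,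
          ← ξ.aut_add, ← ξ.aut_add, neg_neg, neg_add, add_comm (-p) (-q)]
        congr 4
        all_goals first | rfl | abel
      | ha f g hf hg => rw [mul_add, star_add', hf, hg, star_add', add_mul]
    | ha f g hf hg => rw [add_mul, star_add', hf, hg, star_add', mul_add]
  star_add := star_add'

instance : StarModule ℂ (Core ξ) where
  star_smul c f := by
    induction f using induct with
    | h0 => rw [smul_zero, star_zero', smul_zero]
    | hm q a => rw [mono_smul, star_mono, star_mono, mono_smul, star_smul, map_smul]
    | ha f g hf hg => rw [smul_add, star_add', hf, hg, star_add', smul_add]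

/-- The `ℓ¹` norm `∑ ‖a_q‖`. -/
def l1 (f : Core ξ) : ℝ := (SkewMonoidAlgebra.support f).sum fun q => ‖coeff f q.toAdd‖

variable (ξ) in
/-- C*-seminorms on the core algebra, dominated by the `ℓ¹` norm: these are the seminorms
`f ↦ ‖π(f)‖` of the *-representations `π` of the Banach *-algebra `ℓ¹(ℤ^d, A)`. -/
structure CStarSeminorm extends Seminorm ℂ (Core ξ) where
  mul_le' : ∀ f g, toFun (f * g) ≤ toFun f * toFun g
  star_mul_self' : ∀ f, toFun (star f * f) = toFun f ^ 2
  le_l1' : ∀ f, toFun f ≤ l1 f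

theorem CStarSeminorm.star_le (p : CStarSeminorm ξ) (f : Core ξ) :
    p.toSeminorm (star f) = p.toSeminorm f := by
  have key : ∀ g : Core ξ, p.toSeminorm g ≤ p.toSeminorm (star g) := fun g => by
    have h1 : p.toSeminorm g ^ 2 ≤ p.toSeminorm (star g) * p.toSeminorm g :=
      (p.star_mul_self' g).symm.le.trans (p.mul_le' _ _)
    by_contra! h
    have h0 := apply_nonneg p.toSeminorm (star g)
    nlinarith
  exact le_antisymm (by simpa using key (star f)) (key f)

instance : Inhabited (CStarSeminorm ξ) :=
  ⟨{ (0 : Seminorm ℂ (Core ξ)) with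
      mul_le' := fun _ _ => (mul_zero (0 : ℝ)).ge
      star_mul_self' := fun _ => (zero_pow two_ne_zero : (0 : ℝ) ^ 2 = 0).symm
      le_l1' := fun _ => Finset.sum_nonneg fun _ _ => norm_nonneg _ }⟩

variable (ξ) in
/-- The C*-norm of the crossed product: the supremum of all C*-seminorms on the core algebra. -/
def cstarNorm : Seminorm ℂ (Core ξ) := ⨆ p : CStarSeminorm ξ, p.toSeminorm

theorem bddAbove_cstar : BddAbove (Set.range fun p : CStarSeminorm ξ => p.toSeminorm) := by
  rw [Seminorm.bddAbove_range_iff]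
  exact fun f => ⟨l1 f, by rintro _ ⟨p, rfl⟩; exact p.le_l1' f⟩

theorem cstarNorm_apply (f : Core ξ) :
    cstarNorm ξ f = ⨆ p : CStarSeminorm ξ, p.toSeminorm f := Seminorm.iSup_apply bddAbove_cstar

theorem le_cstarNorm (p : CStarSeminorm ξ) (f : Core ξ) : p.toSeminorm f ≤ cstarNorm ξ f := by
  rw [cstarNorm_apply]
  exact le_ciSup (f := fun p : CStarSeminorm ξ => p.toSeminorm f)
    ⟨l1 f, by rintro _ ⟨p, rfl⟩; exact p.le_l1' f⟩ p

theorem cstarNorm_le (f : Core ξ) (C : ℝ) (h : ∀ p : CStarSeminorm ξ, p.toSeminorm f ≤ C) :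
    cstarNorm ξ f ≤ C := by
  rw [cstarNorm_apply]; exact ciSup_le h

theorem cstarNorm_mul_le (f g : Core ξ) :
    cstarNorm ξ (f * g) ≤ cstarNorm ξ f * cstarNorm ξ g :=
  cstarNorm_le _ _ fun p => (p.mul_le' f g).trans <|
    mul_le_mul (le_cstarNorm p f) (le_cstarNorm p g) (apply_nonneg p.toSeminorm g)
      (apply_nonneg _ _)

theorem cstarNorm_star (f : Core ξ) : cstarNorm ξ (star f) = cstarNorm ξ f := by
  rw [cstarNorm_apply, cstarNorm_apply]
  simp only [CStarSeminorm.star_le]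

theorem cstarNorm_star_mul_self (f : Core ξ) : cstarNorm ξ f ^ 2 ≤ cstarNorm ξ (star f * f) := by
  have h : cstarNorm ξ f ≤ √(cstarNorm ξ (star f * f)) := cstarNorm_le _ _ fun p => by
    refine Real.le_sqrt_of_sq_le ?_
    exact (p.star_mul_self' f).symm.le.trans (le_cstarNorm p _)
  calc _ ≤ √(cstarNorm ξ (star f * f)) ^ 2 := pow_le_pow_left₀ (apply_nonneg _ _) h 2
    _ = _ := Real.sq_sqrt (apply_nonneg _ _)

instance : SeminormedRing (Core ξ) where
  norm f := cstarNorm ξ f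
  dist f g := cstarNorm ξ (-f + g)
  dist_eq _ _ := rfl
  dist_self f := by simp
  dist_comm f g := by
    rw [← map_neg_eq_map]
    congr 1
    abel
  dist_triangle f g h := by
    refine le_trans (le_of_eq ?_) (map_add_le_add (cstarNorm ξ) (-f + g) (-g + h))
    congr 1
    abel
  norm_mul_le := cstarNorm_mul_le

theorem norm_def (f : Core ξ) : ‖f‖ = cstarNorm ξ f := rfl

instance : NormedAlgebra ℂ (Core ξ) where
  norm_smul_le c f := (map_smul_eq_mul (cstarNorm ξ) c f).le

instance : NormedStarGroup (Core ξ) := ⟨fun f => (cstarNorm_star f).le⟩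

end Core

/-- The crossed product `A ⋊_ξ ℤ^d`: the completion of the core algebra in its C*-norm. -/
def CrossedProduct (ξ : LatticeAction d A) : Type _ := UniformSpace.Completion (Core ξ)

namespace CrossedProduct

open UniformSpace

variable {ξ : LatticeAction d A}

instance : NormedRing (CrossedProduct ξ) := inferInstanceAs (NormedRing (Completion (Core ξ)))
instance : Algebra ℂ (CrossedProduct ξ) := inferInstanceAs (Algebra ℂ (Completion (Core ξ)))
instance : NormedAlgebra ℂ (CrossedProduct ξ) where
  norm_smul_le := norm_smul_le (α := ℂ) (β := Completion (Core ξ))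
instance : CompleteSpace (CrossedProduct ξ) :=
  inferInstanceAs (CompleteSpace (Completion (Core ξ)))

/-- The inclusion of the core algebra. -/
def ofCore (f : Core ξ) : CrossedProduct ξ := (f : Completion (Core ξ))

theorem norm_ofCore (f : Core ξ) : ‖ofCore f‖ = ‖f‖ := Completion.norm_coe f
theorem ofCore_mul (f g : Core ξ) : ofCore (f * g) = ofCore f * ofCore g := Completion.coe_mul f g
theorem ofCore_add (f g : Core ξ) : ofCore (f + g) = ofCore f + ofCore g := Completion.coe_add f g
theorem ofCore_smul (c : ℂ) (f : Core ξ) : ofCore (c • f) = c • ofCore f := Completion.coe_smul c f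
theorem continuous_ofCore : Continuous (ofCore : Core ξ → CrossedProduct ξ) :=
  Completion.continuous_coe _
theorem denseRange_ofCore : DenseRange (ofCore : Core ξ → CrossedProduct ξ) :=
  Completion.denseRange_coe

theorem uniformContinuous_star : UniformContinuous (star : Core ξ → Core ξ) :=
  star_isometry.uniformContinuous

instance : Star (CrossedProduct ξ) :=
  ⟨(Completion.map star : Completion (Core ξ) → Completion (Core ξ))⟩

theorem continuous_star' : Continuous (star : CrossedProduct ξ → CrossedProduct ξ) :=
  Completion.continuous_map (f := (star : Core ξ → Core ξ))

theorem star_ofCore (f : Core ξ) : star (ofCore f) = ofCore (star f) :=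
  Completion.map_coe uniformContinuous_star f

instance : StarRing (CrossedProduct ξ) where
  star_involutive a := by
    refine denseRange_ofCore.induction_on a
      (isClosed_eq (continuous_star'.comp continuous_star') continuous_id) fun f => ?_
    rw [star_ofCore, star_ofCore, star_star]
  star_mul a b := by
    refine denseRange_ofCore.induction_on₂ (isClosed_eq
      (continuous_star'.comp continuous_mul) ((continuous_star'.comp continuous_snd).mul
        (continuous_star'.comp continuous_fst))) (fun f g => ?_) a b
    rw [← ofCore_mul, star_ofCore, star_ofCore, star_ofCore, star_mul, ofCore_mul]
  star_add a b := by
    refine denseRange_ofCore.induction_on₂ (isClosed_eq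
      (continuous_star'.comp continuous_add) ((continuous_star'.comp continuous_fst).add
        (continuous_star'.comp continuous_snd))) (fun f g => ?_) a b
    rw [← ofCore_add, star_ofCore, star_ofCore, star_ofCore, star_add, ofCore_add]

instance : StarModule ℂ (CrossedProduct ξ) where
  star_smul c a := by
    refine denseRange_ofCore.induction_on a (isClosed_eq
      (continuous_star'.comp (continuous_const_smul c))
      (continuous_star'.const_smul (star c))) fun f => ?_
    rw [← ofCore_smul, star_ofCore, star_ofCore, star_smul, ofCore_smul]

instance : CStarRing (CrossedProduct ξ) where
  norm_mul_self_le a := by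
    refine denseRange_ofCore.induction_on a (isClosed_le (by fun_prop)
      ((continuous_star'.mul continuous_id).norm)) fun f => ?_
    change _ ≤ ‖star (ofCore f) * ofCore f‖
    rw [star_ofCore, ← ofCore_mul, norm_ofCore, norm_ofCore, ← sq]
    exact Core.cstarNorm_star_mul_self f

instance : CStarAlgebra (CrossedProduct ξ) where

end CrossedProduct


section Representation

/-- The shift `∑_x 1 ⊗ E_{x, x-q}`. -/
def shift (q : Fin d → ℤ) : MultAlg A (Fin d → ℤ) := perm (Equiv.subRight q)

theorem shift_apply (q : Fin d → ℤ) (v : StdModule A (Fin d → ℤ)) (x : Fin d → ℤ) :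
    (shift q).1 v x = v (x - q) := rfl

theorem star_shift_apply (q : Fin d → ℤ) (v : StdModule A (Fin d → ℤ)) (x : Fin d → ℤ) :
    (star (shift q)).1 v x = v (x + q) := by
  rw [shift, star_perm]; rfl

theorem norm_shift_le (q : Fin d → ℤ) : ‖(shift q : MultAlg A (Fin d → ℤ))‖ ≤ 1 :=
  norm_permCLM_le _

theorem norm_diag_le {ι : Type*} (f : ι → A) (hf : ∃ C, ∀ x, ‖f x‖ ≤ C) (C : ℝ) (hC : 0 ≤ C)
    (h : ∀ x, ‖f x‖ ≤ C) : ‖diag f hf‖ ≤ C := by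
  have e : diag f hf = ⟨diagCLM f C h, (diag f hf).2⟩ := ext_apply fun v x => rfl
  rw [e]
  exact (norm_diagCLM_le f C h).trans (abs_of_nonneg hC).le

theorem LatticeAction.norm_aut (ξ : LatticeAction d A) (x : Fin d → ℤ) (a : A) :
    ‖ξ.aut x a‖ = ‖a‖ := NonUnitalStarAlgHom.norm_map (ξ.aut x) (EquivLike.injective _) a

theorem LatticeAction.bdd (ξ : LatticeAction d A) (a : A) : ∃ C, ∀ x, ‖ξ.aut x a‖ ≤ C :=
  ⟨‖a‖, fun x => (ξ.norm_aut x a).le⟩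

/-- The element `∑_x ξ_x(a) ⊗ E_{x, x-q}`, the image of the monomial `a · q`. -/
def repMono (ξ : LatticeAction d A) (q : Fin d → ℤ) (a : A) : MultAlg A (Fin d → ℤ) :=
  diag (fun x => ξ.aut x a) (ξ.bdd a) * shift q

theorem repMono_apply (ξ : LatticeAction d A) (q : Fin d → ℤ) (a : A)
    (v : StdModule A (Fin d → ℤ)) (x : Fin d → ℤ) :
    (repMono ξ q a).1 v x = ξ.aut x a * v (x - q) := rfl

theorem norm_repMono_le (ξ : LatticeAction d A) (q : Fin d → ℤ) (a : A) :
    ‖repMono ξ q a‖ ≤ ‖a‖ := by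
  refine (norm_mul_le _ _).trans ?_
  calc _ ≤ ‖a‖ * 1 := by
        gcongr
        · exact norm_diag_le _ _ _ (norm_nonneg a) fun x => (ξ.norm_aut x a).le
        · exact norm_shift_le q
    _ = ‖a‖ := mul_one _

theorem repMono_add (ξ : LatticeAction d A) (q : Fin d → ℤ) (a b : A) :
    repMono ξ q (a + b) = repMono ξ q a + repMono ξ q b :=
  ext_apply fun v x => by simp [repMono_apply, add_mul]

/-- The additive map underlying the representation of the core algebra. -/
def coreRepAdd (ξ : LatticeAction d A) : Core ξ →+ MultAlg A (Fin d → ℤ) :=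
  Core.lift fun q => AddMonoidHom.mk' (repMono ξ q) (repMono_add ξ q)

theorem coreRepAdd_mono (ξ : LatticeAction d A) (q : Fin d → ℤ) (a : A) :
    coreRepAdd ξ (Core.mono ξ q a) = repMono ξ q a := Core.lift_mono _ _ _

theorem coreRepAdd_mul (ξ : LatticeAction d A) (f g : Core ξ) :
    coreRepAdd ξ (f * g) = coreRepAdd ξ f * coreRepAdd ξ g := by
  induction f using Core.induct with
  | h0 => simp
  | hm p a =>
    induction g using Core.induct with
    | h0 => simp
    | hm q b =>
      rw [Core.mono_mul, coreRepAdd_mono, coreRepAdd_mono, coreRepAdd_mono]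
      refine ext_apply fun v x => ?_
      rw [repMono_apply, coe_mul, mul_apply_eq_comp, repMono_apply, repMono_apply,
        map_mul, ← ξ.aut_add, mul_assoc, sub_add_eq_sub_sub, sub_eq_add_neg x p]
    | ha g g' h h' => rw [mul_add, map_add, h, h', map_add, mul_add]
  | ha f f' h h' => rw [add_mul, map_add, h, h', map_add, add_mul]

theorem star_repMono (ξ : LatticeAction d A) (q : Fin d → ℤ) (a : A) :
    star (repMono ξ q a) = repMono ξ (-q) (ξ.aut q (star a)) := by
  rw [repMono, star_mul, star_diag _ _ (by simpa using ξ.bdd a)]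
  refine ext_apply fun v x => ?_
  rw [coe_mul, mul_apply_eq_comp, star_shift_apply, diag_apply, repMono_apply,
    ← ξ.aut_add, map_star, sub_neg_eq_add]

/-- The representation `π̂` on the core algebra. -/
def coreRep (ξ : LatticeAction d A) : Core ξ →⋆ₐ[ℂ] MultAlg A (Fin d → ℤ) where
  toFun := coreRepAdd ξ
  map_one' := by
    rw [Core.one_def, coreRepAdd_mono]
    refine ext_apply fun v x => ?_
    rw [repMono_apply, map_one, one_mul, sub_zero]; rfl
  map_mul' := coreRepAdd_mul ξ
  map_zero' := map_zero _
  map_add' := map_add _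
  commutes' c := by
    rw [Algebra.algebraMap_eq_smul_one, Core.one_def, Core.mono_smul, coreRepAdd_mono,
      Algebra.algebraMap_eq_smul_one]
    refine ext_apply fun v x => ?_
    rw [repMono_apply, map_smul, map_one, sub_zero, smul_mul_assoc, one_mul]; rfl
  map_star' f := by
    induction f using Core.induct with
    | h0 => simp
    | hm q a => rw [Core.star_mono, coreRepAdd_mono, coreRepAdd_mono, star_repMono]
    | ha f g h h' => rw [star_add, map_add, h, h', map_add, star_add]

theorem coreRep_mono (ξ : LatticeAction d A) (q : Fin d → ℤ) (a : A) :
    coreRep ξ (Core.mono ξ q a) = repMono ξ q a := coreRepAdd_mono ξ q a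

/-- The C*-seminorm induced by the representation on `H_A`. -/
def repSeminorm (ξ : LatticeAction d A) : Core.CStarSeminorm ξ where
  toFun f := ‖coreRep ξ f‖
  map_zero' := by simp
  add_le' f g := by rw [map_add]; exact norm_add_le _ _
  neg' f := by rw [map_neg, norm_neg]
  smul' c f := by rw [map_smul, norm_smul]
  mul_le' f g := by rw [map_mul]; exact norm_mul_le _ _
  star_mul_self' f := by rw [map_mul, map_star, CStarRing.norm_star_mul_self, sq]
  le_l1' f := (norm_sum_le _ _).trans (Finset.sum_le_sum fun q _ => norm_repMono_le ξ _ _)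

theorem norm_coreRep_le (ξ : LatticeAction d A) (f : Core ξ) : ‖coreRep ξ f‖ ≤ ‖f‖ :=
  Core.le_cstarNorm (repSeminorm ξ) f

theorem continuous_coreRep (ξ : LatticeAction d A) : Continuous (coreRep ξ) :=
  AddMonoidHomClass.continuous_of_bound (coreRep ξ) 1 fun f => by
    rw [one_mul]; exact norm_coreRep_le ξ f

/-- The extension of `coreRep` by continuity, as a ring homomorphism. -/
def repRingHom (ξ : LatticeAction d A) : CrossedProduct ξ →+* MultAlg A (Fin d → ℤ) :=
  UniformSpace.Completion.extensionHom (coreRep ξ : Core ξ →+* MultAlg A (Fin d → ℤ))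
    (continuous_coreRep ξ)

theorem continuous_repRingHom (ξ : LatticeAction d A) : Continuous (repRingHom ξ) :=
  UniformSpace.Completion.continuous_extension

theorem repRingHom_ofCore (ξ : LatticeAction d A) (f : Core ξ) :
    repRingHom ξ (CrossedProduct.ofCore f) = coreRep ξ f :=
  UniformSpace.Completion.extensionHom_coe _ (continuous_coreRep ξ) f

/-- The representation `π̂ : A ⋊_ξ ℤ^d → M(A ⊗ K)`, the continuous extension of
`a · q ↦ ∑_x ξ_x(a) ⊗ E_{x, x-q}`. -/
def rep (ξ : LatticeAction d A) : CrossedProduct ξ →⋆ₐ[ℂ] MultAlg A (Fin d → ℤ) where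
  __ := repRingHom ξ
  commutes' c := by
    have h : algebraMap ℂ (CrossedProduct ξ) c =
        CrossedProduct.ofCore (algebraMap ℂ (Core ξ) c) := rfl
    change repRingHom ξ (algebraMap ℂ (CrossedProduct ξ) c) = _
    rw [h, repRingHom_ofCore]
    exact AlgHomClass.commutes (coreRep ξ) c
  map_star' a := by
    change repRingHom ξ (star a) = star (repRingHom ξ a)
    refine CrossedProduct.denseRange_ofCore.induction_on a (isClosed_eq
      ((continuous_repRingHom ξ).comp CrossedProduct.continuous_star')
      (continuous_repRingHom ξ).star) fun f => ?_
    rw [CrossedProduct.star_ofCore, repRingHom_ofCore, repRingHom_ofCore, map_star]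

theorem rep_ofCore (ξ : LatticeAction d A) (f : Core ξ) :
    rep ξ (CrossedProduct.ofCore f) = coreRep ξ f := repRingHom_ofCore ξ f

theorem continuous_rep (ξ : LatticeAction d A) : Continuous (rep ξ) := continuous_repRingHom ξ

theorem entry_repMono (ξ : LatticeAction d A) (q : Fin d → ℤ) (a : A) (x y : Fin d → ℤ) :
    entry (repMono ξ q a) x y = ξ.aut x (if q = x - y then a else 0) := by
  rw [entry, repMono_apply]
  by_cases h : x - q = y
  · rw [h, StdModule.single_same, mul_one, if_pos (by rw [← h]; abel)]
  · rw [StdModule.single_ne h, mul_zero, if_neg (fun h' => h (by rw [h']; abel)), map_zero]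

theorem entry_coreRep (ξ : LatticeAction d A) (f : Core ξ) (x y : Fin d → ℤ) :
    entry (coreRep ξ f) x y = ξ.aut x (f.coeff (x - y)) := by
  induction f using Core.induct with
  | h0 => rw [map_zero, Core.coeff_zero, map_zero]; rfl
  | hm q a => rw [coreRep_mono, entry_repMono, Core.coeff_mono]
  | ha f g h h' => rw [map_add, entry_add, h, h', Core.coeff_add, map_add]

theorem norm_coeff_le (ξ : LatticeAction d A) (f : Core ξ) (q : Fin d → ℤ) :
    ‖f.coeff q‖ ≤ ‖f‖ := by
  have h := norm_entry_le (coreRep ξ f) q 0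
  rw [entry_coreRep, sub_zero, ξ.norm_aut] at h
  exact h.trans (norm_coreRep_le ξ f)

/-- The coefficient map on the core algebra, as a continuous linear map. -/
def coeffCLM (ξ : LatticeAction d A) (q : Fin d → ℤ) : Core ξ →L[ℂ] A :=
  LinearMap.mkContinuous
    { toFun := fun f => f.coeff q
      map_add' := fun f g => Core.coeff_add f g q
      map_smul' := fun c f => Core.coeff_smul c f q } 1 fun f => by
    rw [one_mul]; exact norm_coeff_le ξ f q

/-- The Fourier coefficient `Φ_q`: the continuous linear map `A ⋊_ξ ℤ^d → A` with
`Φ_q (∑ a_p · p) = a_q` on finite sums. It agrees with the average of `ρ_λ(a u_q⁻¹)` over the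
torus, `ρ_λ(∑ a_p · p) = ∑ λ^p a_p · p`, as both are continuous and agree on finite sums. -/
def fourier (ξ : LatticeAction d A) (q : Fin d → ℤ) : CrossedProduct ξ → A :=
  (coeffCLM ξ q).fromCompletion

theorem fourier_ofCore (ξ : LatticeAction d A) (q : Fin d → ℤ) (f : Core ξ) :
    fourier ξ q (CrossedProduct.ofCore f) = f.coeff q :=
  (coeffCLM ξ q).fromCompletion_apply_coe f

theorem continuous_fourier (ξ : LatticeAction d A) (q : Fin d → ℤ) : Continuous (fourier ξ q) :=
  (coeffCLM ξ q).fromCompletion.continuous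

/-- `π̂(a) = ∑_{x,q} ξ_x Φ_q(a) ⊗ E_{x, x-q}`. -/
theorem entry_rep (ξ : LatticeAction d A) (a : CrossedProduct ξ) (x y : Fin d → ℤ) :
    entry (rep ξ a) x y = ξ.aut x (fourier ξ (x - y) a) := by
  have hc : Continuous fun T : MultAlg A (Fin d → ℤ) => entry T x y := by
    refine continuous_iff_continuousAt.2 fun T => ?_
    rw [ContinuousAt, tendsto_iff_norm_sub_tendsto_zero]
    refine squeeze_zero (fun _ => norm_nonneg _) (fun S => norm_entry_le (S - T) x y) ?_
    exact tendsto_iff_norm_sub_tendsto_zero.1 tendsto_id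
  have hξ : Continuous fun a => ξ.aut x a :=
    AddMonoidHomClass.continuous_of_bound (ξ.aut x) 1 fun a => by
      rw [one_mul]; exact (ξ.norm_aut x a).le
  refine CrossedProduct.denseRange_ofCore.induction_on a (isClosed_eq
    (hc.comp (continuous_rep ξ)) (hξ.comp (continuous_fourier ξ _))) fun f => ?_
  rw [rep_ofCore, fourier_ofCore, entry_coreRep]

end Representation

/-- The Euclidean length `|q|` of a lattice vector. -/
def latticeNorm (q : Fin d → ℤ) : ℝ := √(∑ i, (q i : ℝ) ^ 2)

/-- `(A ⋊_ξ ℤ^d)_loc`: the elements with exponentially decaying Fourier coefficients. -/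
def locAlgebra (ξ : LatticeAction d A) : Set (CrossedProduct ξ) :=
  {a | ∃ α : ℝ, 0 < α ∧ α < 1 ∧
    BddAbove (Set.range fun q : Fin d → ℤ => α ^ (-latticeNorm q) * ‖fourier ξ q a‖)}

/-- A continuous, faithful, positive, `ξ`-invariant trace on `A`. -/
structure InvariantTrace (ξ : LatticeAction d A) where
  toCLM : A →L[ℂ] ℂ
  nonneg : ∀ a, 0 ≤ (toCLM (star a * a)).re ∧ (toCLM (star a * a)).im = 0
  tracial : ∀ a b, toCLM (a * b) = toCLM (b * a)
  faithful : ∀ a, toCLM (star a * a) = 0 → a = 0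
  invariant : ∀ x a, toCLM (ξ.aut x a) = toCLM a

end CrossedProduct

section TraceClass

open MultAlg

variable {A : Type*} [CStarAlgebra A] {d : ℕ}

/-- `S` is the elementary tensor `a ⊗ T` with `T` a bounded operator on `ℓ²(ℤ^d)`,
i.e. `S_xy = ⟨δ_x, T δ_y⟩ a`. -/
def IsElementaryTensor (S : MultAlg A (Fin d → ℤ)) : Prop :=
  ∃ (a : A) (T : lp (fun _ : Fin d → ℤ => ℂ) 2 →L[ℂ] lp (fun _ : Fin d → ℤ => ℂ) 2),
    ∀ x y, entry S x y = (T (lp.single 2 y (1 : ℂ)) x) • a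

variable (A d) in
/-- The spatial tensor product `A ⊗ B(ℓ²(ℤ^d))`, as a closed subspace of `M(A ⊗ K)`. -/
def tensorB : Submodule ℂ (MultAlg A (Fin d → ℤ)) :=
  (Submodule.span ℂ {S | IsElementaryTensor S}).topologicalClosure

variable {ξ : LatticeAction d A}

/-- The trace `∑_x τ(T_xx) ∈ [0, ∞]` of a positive element. -/
def InvariantTrace.extended (τ : InvariantTrace ξ) (T : MultAlg A (Fin d → ℤ)) : ENNReal :=
  ∑' x, ENNReal.ofReal (τ.toCLM (entry T x x)).re

/-- The trace-class elements: the span of the positive elements `S^* S`, `S ∈ A ⊗ B`, of finite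
trace. -/
def InvariantTrace.traceClass (τ : InvariantTrace ξ) : Submodule ℂ (MultAlg A (Fin d → ℤ)) :=
  Submodule.span ℂ {T | (∃ S ∈ tensorB A d, T = star S * S) ∧ τ.extended T < ⊤}

end TraceClass

section FredholmModule

open MultAlg TensorProduct

/-- The quadratic form `∑ z_i²` on `ℂ^d`. -/
def cliffordForm (d : ℕ) : QuadraticForm ℂ (Fin d → ℂ) :=
  QuadraticMap.weightedSumSquares ℂ fun _ : Fin d => (1 : ℂ)

/-- The complex Clifford algebra on `d` generators with `γ_i γ_j + γ_j γ_i = 2 δ_ij`. -/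
abbrev Cl (d : ℕ) : Type := CliffordAlgebra (cliffordForm d)

/-- The generators `γ_i`. -/
def gamma {d : ℕ} (i : Fin d) : Cl d := CliffordAlgebra.ι (cliffordForm d) (Pi.single i 1)

theorem gamma_mul_gamma {d : ℕ} (i j : Fin d) :
    gamma i * gamma j + gamma j * gamma i = if i = j then 2 else 0 := by
  have h : QuadraticMap.polar (cliffordForm d) (Pi.single i 1) (Pi.single j 1) =
      if i = j then 2 else 0 := by
    simp only [QuadraticMap.polar, cliffordForm, QuadraticMap.weightedSumSquares_apply,
      Pi.add_apply, one_smul, ← Finset.sum_sub_distrib]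
    by_cases h : i = j
    · subst h
      rw [Finset.sum_eq_single i (fun k _ hk => by simp [hk]) (by simp)]
      norm_num
    · rw [if_neg h]
      refine Finset.sum_eq_zero fun k _ => ?_
      by_cases hi : k = i
      · simp [hi, h]
      · simp [hi]
  rw [gamma, gamma, CliffordAlgebra.ι_mul_ι_add_swap, h]
  split_ifs
  · exact map_ofNat _ 2
  · exact map_zero _

/-- `γ_0 = -i^{d/2} γ_1 ⋯ γ_d`. -/
def gammaZero (d : ℕ) : Cl d := -(Complex.I ^ (d / 2) • (List.ofFn fun i : Fin d => gamma i).prod)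

variable {A : Type*} [CStarAlgebra A] {d : ℕ}

/-- The translate `x + x₀`. -/
def translate (x₀ : EuclideanSpace ℝ (Fin d)) (x : Fin d → ℤ) : EuclideanSpace ℝ (Fin d) :=
  WithLp.toLp 2 fun i => (x i : ℝ) + x₀ i

open Classical in
/-- The unit vector `(x + x₀)/|x + x₀|`, replaced by `w` at a point with `x + x₀ = 0`. -/
def direction (w x₀ : EuclideanSpace ℝ (Fin d)) (x : Fin d → ℤ) : EuclideanSpace ℝ (Fin d) :=
  if translate x₀ x = 0 then w else ‖translate x₀ x‖⁻¹ • translate x₀ x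

theorem direction_bdd (w x₀ : EuclideanSpace ℝ (Fin d)) (i : Fin d) :
    ∃ C, ∀ x, ‖((direction w x₀ x i : ℝ) : ℂ) • (1 : A)‖ ≤ C := by
  refine ⟨max ‖w‖ 1 * ‖(1 : A)‖, fun x => ?_⟩
  rw [norm_smul, Complex.norm_real]
  gcongr
  refine (PiLp.norm_apply_le _ i).trans ?_
  rw [direction]
  split_ifs with h
  · exact le_max_left _ _
  · refine le_trans (le_of_eq ?_) (le_max_right _ _)
    rw [norm_smul, norm_inv, norm_norm, inv_mul_cancel₀ (norm_ne_zero_iff.2 h)]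

variable (A) in
/-- The phase `∑_x γ·(x + x₀)/|x + x₀| ⊗ 1 ⊗ E_xx` of the Dirac element. -/
def diracPhase (w x₀ : EuclideanSpace ℝ (Fin d)) : Cl d ⊗[ℂ] MultAlg A (Fin d → ℤ) :=
  ∑ i, gamma i ⊗ₜ[ℂ]
    diag (fun x => ((direction w x₀ x i : ℝ) : ℂ) • (1 : A)) (direction_bdd w x₀ i)

/-- A quadruple (algebra `C`, representation of `B` in `C`, phase, grading). -/
structure FredholmQuadruple (B C : Type*) [Ring B] [Algebra ℂ B] [Ring C] [Algebra ℂ C] where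
  rep : B →ₐ[ℂ] C
  phase : C
  grading : C

/-- The unit cube `[0,1]^d`. -/
def unitCube (d : ℕ) : Set (EuclideanSpace ℝ (Fin d)) := {x₀ | ∀ i, x₀ i ∈ Set.Icc (0 : ℝ) 1}

/-- The intrinsic family `(Cl_d ⊗ M(A ⊗ K), π̂_γ, phase, γ)` indexed by `x₀ ∈ [0,1]^d`. -/
def intrinsicFamily (ξ : LatticeAction d A) (w : EuclideanSpace ℝ (Fin d)) (x₀ : unitCube d) :
    FredholmQuadruple (CrossedProduct ξ) (Cl d ⊗[ℂ] MultAlg A (Fin d → ℤ)) where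
  rep := Algebra.TensorProduct.includeRight.comp (rep ξ).toAlgHom
  phase := diracPhase A w x₀
  grading := gammaZero d ⊗ₜ 1

/-- `n`-summability of a family over a subset of the algebra, relative to an ideal `J`. -/
def IsSummableOver {B C κ : Type*} [Ring B] [Algebra ℂ B] [Ring C] [Algebra ℂ C]
    (F : κ → FredholmQuadruple B C) (n : ℕ) (s : Set B) (J : Submodule ℂ C) : Prop :=
  ∀ k, ∀ a : Fin n → B, (∀ i, a i ∈ s) →
    (List.ofFn fun i => (F k).phase * (F k).rep (a i) - (F k).rep (a i) * (F k).phase).prod ∈ J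

/-- `Cl_d ⊗ S_1`. -/
def InvariantTrace.cliffordTraceClass {ξ : LatticeAction d A} (τ : InvariantTrace ξ) :
    Submodule ℂ (Cl d ⊗[ℂ] MultAlg A (Fin d → ℤ)) :=
  LinearMap.range (LinearMap.lTensor (Cl d) τ.traceClass.subtype)

end FredholmModule

end Intrinsic

end

/-!
The argument is the symbol calculus of operators of negative order on the lattice. An adjointable
operator `T` on `H_A` has order `-k` (`decayModule`) if its entries satisfy
`‖T_xy‖ ≤ C_m ⟨x - y⟩^{-m} ⟨x⟩^{-k}` for every `m`, where `⟨x⟩ = 1 + ‖x‖`.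

* For `a` in the local algebra the entries of `[sign, π̂(a)]` are `(u_x - u_y) ξ_x(Φ_{x-y}(a))`,
  with `u_x` the direction of `x + x₀`. The direction field satisfies `⟨x⟩ |u_x - u_y| ≤ C ⟨x - y⟩`,
  and the Fourier coefficients decay exponentially, so each Clifford component of the commutator has
  order `-1` (`commutator_mem_decayModule`).
* Orders add under multiplication (`mul_mem_decayModule`), so the components of a product of
  `n ≥ d + 1` commutators have order `-(d + 1)`.
* Operators of order `-(d + 1)` are of trace class (`InvariantTrace.decayModule_le_traceClass`).
  Indeed `T = P R` with `P = ∑_x ⟨x⟩^{-(d+1)/2} ⊗ E_xx`, and both factors have entries bounded by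
  `C ⟨x - y⟩^{-(d+1)} ⟨x⟩^{-(d+1)/2}`. A matrix `S` with this bound is square summable, as
  `∑_x ⟨x⟩^{-(d+1)} < ∞` on `ℤ^d`, so `S^* S` has finite trace; and it lies in `A ⊗ B`, because it
  is the norm convergent sum of its diagonals and each diagonal vanishes at infinity, hence is a
  norm limit of finite matrices. Apply this to `S = P + zR` and polarize.
-/

noncomputable section

namespace Intrinsic

open Filter Topology MultAlg

/-! ### Matrix entries of adjointable operators -/

section Entries

variable {A : Type*} [CStarAlgebra A] {ι : Type*}

namespace MultAlg

theorem entry_star (T : MultAlg A ι) (x y : ι) : entry (star T) x y = star (entry T y x) := by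
  have h := isAdjointOf_star T (StdModule.single x 1) (StdModule.single y 1)
  rw [StdModule.ip_single_left, star_one, one_mul, ← StdModule.star_ip,
    StdModule.ip_single_left, star_one, one_mul] at h
  exact h.symm

/-- An adjointable operator acts by its matrix: `(T v)_x = ∑_y T_xy v_y`. -/
theorem hasSum_entry_mul (T : MultAlg A ι) (v : StdModule A ι) (x : ι) :
    HasSum (fun y => entry T x y * v y) (T.1 v x) := by
  have h := StdModule.hasSum_ip ((star T).1 (StdModule.single x 1)) v
  have hadj := isAdjointOf_star (star T) (StdModule.single x 1) v
  rw [star_star, StdModule.ip_single_left, star_one, one_mul] at hadj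
  rw [hadj] at h
  refine h.congr_fun fun y => ?_
  change entry T x y * v y = star (entry (star T) y x) * v y
  rw [entry_star, star_star]

theorem ext_entry {T S : MultAlg A ι} (h : ∀ x y, entry T x y = entry S x y) : T = S :=
  ext_apply fun v x => (hasSum_entry_mul T v x).unique
    ((hasSum_entry_mul S v x).congr_fun fun y => by rw [h])

theorem hasSum_entry_mul_entry (T S : MultAlg A ι) (x z : ι) :
    HasSum (fun y => entry T x y * entry S y z) (entry (T * S) x z) :=
  hasSum_entry_mul T (S.1 (StdModule.single z 1)) x

theorem entry_sub (T S : MultAlg A ι) (x y : ι) : entry (T - S) x y = entry T x y - entry S x y :=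
  rfl

theorem entry_zero (x y : ι) : entry (0 : MultAlg A ι) x y = 0 := rfl

variable (A) in
/-- The matrix entry as a continuous linear map. -/
def entryCLM (x y : ι) : MultAlg A ι →L[ℂ] A :=
  LinearMap.mkContinuous
    { toFun := fun T => entry T x y
      map_add' := fun T S => entry_add T S x y
      map_smul' := fun c T => entry_smul c T x y } 1 fun T => by
    rw [one_mul]; exact norm_entry_le T x y

theorem entryCLM_apply (x y : ι) (T : MultAlg A ι) : entryCLM A x y T = entry T x y := rfl

open Classical in
theorem entry_diag (f : ι → A) (hf : ∃ C, ∀ x, ‖f x‖ ≤ C) (x y : ι) :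
    entry (diag f hf) x y = if x = y then f x else 0 := by
  rw [entry, diag_apply]
  split_ifs with h
  · rw [h, StdModule.single_same, mul_one]
  · rw [StdModule.single_ne h, mul_zero]

theorem entry_diag_mul (f : ι → A) (hf : ∃ C, ∀ x, ‖f x‖ ≤ C) (T : MultAlg A ι) (x y : ι) :
    entry (diag f hf * T) x y = f x * entry T x y := rfl

theorem entry_mul_diag (f : ι → A) (hf : ∃ C, ∀ x, ‖f x‖ ≤ C) (T : MultAlg A ι) (x y : ι) :
    entry (T * diag f hf) x y = entry T x y * f y := by
  classical
  refine (hasSum_entry_mul_entry T (diag f hf) x y).unique ?_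
  have := hasSum_single (f := fun z => entry T x z * entry (diag f hf) z y) y
    fun z hz => by rw [entry_diag, if_neg hz, mul_zero]
  rwa [entry_diag, if_pos rfl] at this

end MultAlg

end Entries

/-! ### Matrices as sums of their diagonals -/

section DiagShift

variable {A : Type*} [CStarAlgebra A] {d : ℕ}

theorem entry_diag_mul_shift (f : (Fin d → ℤ) → A) (hf : ∃ C, ∀ x, ‖f x‖ ≤ C)
    (q x y : Fin d → ℤ) :
    entry (diag f hf * shift q) x y = if q = x - y then f x else 0 := by
  rw [entry_diag_mul, entry, shift_apply]
  by_cases h : x - q = y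
  · rw [h, StdModule.single_same, mul_one, if_pos (by rw [← h]; abel)]
  · rw [StdModule.single_ne h, mul_zero, if_neg (fun h' => h (by rw [h']; abel))]

theorem norm_diag_mul_shift_le (f : (Fin d → ℤ) → A) (hf : ∃ C, ∀ x, ‖f x‖ ≤ C)
    (q : Fin d → ℤ) (C : ℝ) (hC : 0 ≤ C) (h : ∀ x, ‖f x‖ ≤ C) :
    ‖diag f hf * shift q‖ ≤ C := by
  refine (norm_mul_le _ _).trans ?_
  calc _ ≤ C * 1 := by
        gcongr
        · exact norm_diag_le f hf C hC h
        · exact norm_shift_le q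
    _ = C := mul_one C

/-- A matrix whose diagonals `x ↦ K_{x,x-q}` have summable sup norms `≤ w q` is the norm
convergent sum of its diagonals. -/
theorem exists_hasSum_diag_mul_shift (K : (Fin d → ℤ) → (Fin d → ℤ) → A) (w : (Fin d → ℤ) → ℝ)
    (hw : Summable w) (hK : ∀ x y, ‖K x y‖ ≤ w (x - y)) :
    ∃ T : MultAlg A (Fin d → ℤ), (∀ x y, entry T x y = K x y) ∧
      HasSum (fun q => diag (fun x => K x (x - q))
        ⟨w q, fun x => by simpa using hK x (x - q)⟩ * shift q) T := by
  have hK' : ∀ q x, ‖K x (x - q)‖ ≤ w q := fun q x => by simpa using hK x (x - q)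
  have hs : Summable (fun q => diag (fun x => K x (x - q)) ⟨w q, hK' q⟩ * shift q) :=
    Summable.of_norm_bounded hw fun q =>
      norm_diag_mul_shift_le _ _ q _ ((norm_nonneg _).trans (hK' q 0)) (hK' q)
  refine ⟨_, fun x y => ?_, hs.hasSum⟩
  refine (hs.hasSum.mapL (entryCLM A x y)).unique ?_
  have := hasSum_single (f := fun q => entryCLM A x y
    (diag (fun x => K x (x - q)) ⟨w q, hK' q⟩ * shift q)) (x - y) fun q hq => by
      rw [entryCLM_apply, entry_diag_mul_shift, if_neg hq]
  rwa [entryCLM_apply, entry_diag_mul_shift, if_pos rfl, sub_sub_cancel] at this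

end DiagShift

/-! ### Membership in the spatial tensor product -/

section Tensor

variable {A : Type*} [CStarAlgebra A] {d : ℕ}

open Classical in
/-- A matrix with a single nonzero entry is an elementary tensor `a ⊗ E_{x,y}`. -/
theorem isElementaryTensor_of_entry_eq (T : MultAlg A (Fin d → ℤ)) (a : A) (x₁ y₁ : Fin d → ℤ)
    (h : ∀ x y, entry T x y = if x = x₁ ∧ y = y₁ then a else 0) : IsElementaryTensor T := by
  -- `E_{x₁,y₁}` as the rank-one operator `v ↦ ⟨δ_{y₁}, v⟩ δ_{x₁}`.
  refine ⟨a, (innerSL ℂ (lp.single 2 y₁ (1 : ℂ))).smulRight (lp.single 2 x₁ (1 : ℂ)),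
    fun x y => ?_⟩
  rw [h, ContinuousLinearMap.smulRight_apply, innerSL_apply_apply, lp.inner_single_left]
  by_cases hx : x = x₁ <;> by_cases hy : y = y₁
  · simp [hx, hy]
  · have hy' : y₁ ≠ y := Ne.symm hy
    simp [hx, hy, hy', lp.single_apply]
  · simp [hx, hy, lp.single_apply]
  · simp [hx, hy, lp.single_apply]

/-- A diagonal of entries vanishing at infinity is a norm limit of finite matrices. -/
theorem diag_mul_shift_mem_tensorB (f : (Fin d → ℤ) → A) (hf : ∃ C, ∀ x, ‖f x‖ ≤ C)
    (h0 : Tendsto f cofinite (𝓝 0)) (q : Fin d → ℤ) : diag f hf * shift q ∈ tensorB A d := by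
  classical
  rw [tensorB, ← SetLike.mem_coe, Submodule.topologicalClosure_coe, Metric.mem_closure_iff]
  intro ε hε
  -- Keep the finitely many entries of norm at least `ε / 2`.
  have hfin : {x | ¬ ‖f x‖ < ε / 2}.Finite := by
    have := (Metric.tendsto_nhds.1 h0) (ε / 2) (half_pos hε)
    simpa [dist_zero_right, Filter.eventually_cofinite] using this
  set F := hfin.toFinset with hF
  have hbd : ∀ x : Fin d → ℤ, ∃ C, ∀ z, ‖(Pi.single x (f x) : (Fin d → ℤ) → A) z‖ ≤ C := fun x =>
    ⟨‖f x‖, fun z => by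
      by_cases h : z = x
      · rw [h, Pi.single_eq_same]
      · rw [Pi.single_eq_of_ne h, norm_zero]; exact norm_nonneg _⟩
  refine ⟨∑ x ∈ F, diag (Pi.single x (f x)) (hbd x) * shift q, ?_, ?_⟩
  · refine Submodule.sum_mem _ fun x _ => Submodule.subset_span ?_
    refine isElementaryTensor_of_entry_eq _ (f x) x (x - q) fun z y => ?_
    rw [entry_diag_mul_shift]
    by_cases hz : z = x
    · subst hz
      have : q = z - y ↔ y = z - q := ⟨fun h => by rw [h]; abel, fun h => by rw [h]; abel⟩
      simp [this]
    · simp [hz]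
  · have hg : ∀ x, ‖(if x ∈ F then 0 else f x)‖ ≤ ε / 2 := fun x => by
      split_ifs with h
      · rw [norm_zero]; positivity
      · have : ‖f x‖ < ε / 2 := by simpa [hF] using h
        exact this.le
    have e : diag f hf * shift q - ∑ x ∈ F, diag (Pi.single x (f x)) (hbd x) * shift q =
        diag (fun x => if x ∈ F then 0 else f x) ⟨ε / 2, hg⟩ * shift q := by
      refine ext_entry fun x y => ?_
      rw [entry_sub, ← entryCLM_apply x y (∑ _ ∈ F, _), map_sum]
      simp only [entryCLM_apply, entry_diag_mul_shift]
      by_cases h : q = x - y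
      · simp only [if_pos h]
        by_cases hx : x ∈ F
        · rw [Finset.sum_eq_single x (fun z _ hz => Pi.single_eq_of_ne (Ne.symm hz) _)
            (fun h' => absurd hx h'), Pi.single_eq_same, sub_self, if_pos hx]
        · rw [Finset.sum_eq_zero (fun z hz => Pi.single_eq_of_ne (fun h' => hx (by rwa [h'])) _),
            sub_zero, if_neg hx]
      · simp [h]
    rw [dist_eq_norm, e]
    exact (norm_diag_mul_shift_le _ _ q (ε / 2) (half_pos hε).le hg).trans_lt (half_lt_self hε)

/-- A matrix whose entries are dominated by `w (x - y) p(x)`, with `w` summable and `p` vanishing at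
infinity, lies in `A ⊗ B`. -/
theorem mem_tensorB_of_norm_entry_le (T : MultAlg A (Fin d → ℤ)) (w p : (Fin d → ℤ) → ℝ)
    (hw : Summable w) (hp : Tendsto p cofinite (𝓝 0)) (hp1 : ∀ x, p x ≤ 1) (hw0 : ∀ x, 0 ≤ w x)
    (h : ∀ x y, ‖entry T x y‖ ≤ w (x - y) * p x) : T ∈ tensorB A d := by
  obtain ⟨S, hS, hsum⟩ := exists_hasSum_diag_mul_shift (entry T) w hw fun x y =>
    (h x y).trans (mul_le_of_le_one_right (hw0 _) (hp1 _))
  obtain rfl : T = S := ext_entry fun x y => (hS x y).symm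
  have hc : IsClosed (tensorB A d : Set (MultAlg A (Fin d → ℤ))) :=
    Submodule.isClosed_topologicalClosure _
  refine hc.mem_of_tendsto hsum (Eventually.of_forall fun F => Submodule.sum_mem _ fun q _ => ?_)
  refine diag_mul_shift_mem_tensorB _ _ ?_ q
  refine squeeze_zero_norm (fun x => h x (x - q)) ?_
  simpa using hp.const_mul (w q)

end Tensor

/-! ### Lattice weights and the direction field -/

section Weight

variable {d : ℕ}

/-- The weight `⟨x⟩ = 1 + ‖x‖` on the lattice, with the sup norm. -/
def bracket (x : Fin d → ℤ) : ℝ := 1 + ‖x‖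

theorem one_le_bracket (x : Fin d → ℤ) : 1 ≤ bracket x := le_add_of_nonneg_right (norm_nonneg x)

theorem bracket_pos (x : Fin d → ℤ) : 0 < bracket x := zero_lt_one.trans_le (one_le_bracket x)

theorem bracket_add_le (x y : Fin d → ℤ) : bracket (x + y) ≤ bracket x * bracket y := by
  have := norm_add_le x y
  rw [bracket, bracket, bracket]
  nlinarith [mul_nonneg (norm_nonneg x) (norm_nonneg y)]

/-- Summability over the lattice; the junk value `0⁻¹ = 0` removes the origin from the sum. -/
theorem summable_norm_inv_pow (d : ℕ) : Summable fun x : Fin d → ℤ => ‖x‖⁻¹ ^ (d + 1) := by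
  let b := Pi.basisFun ℝ (Fin d)
  let L : Submodule ℤ (Fin d → ℝ) := Submodule.span ℤ (Set.range b)
  have hL : Module.finrank ℤ L = d := by
    rw [ZLattice.rank ℝ L]; simp
  have h := ZLattice.summable_norm_pow_inv L (d + 1) (by rw [hL]; exact d.lt_succ_self)
  have hmem : ∀ x : Fin d → ℤ, (fun i => (x i : ℝ)) ∈ L := fun x => by
    rw [Module.Basis.mem_span_iff_repr_mem]
    exact fun i => ⟨x i, by simp [b]⟩
  let e : (Fin d → ℤ) → L := fun x => ⟨fun i => (x i : ℝ), hmem x⟩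
  have he : Function.Injective e := fun x y hxy => by
    funext i
    exact Int.cast_injective (α := ℝ) (congrFun (congrArg Subtype.val hxy) i)
  refine (h.comp_injective he).congr fun x => ?_
  have : ‖e x‖ = ‖x‖ := by
    change ‖(fun i => (x i : ℝ))‖ = ‖x‖
    simp [Pi.norm_def]
    rfl
  rw [Function.comp, this]

theorem summable_bracket_inv_pow (d : ℕ) :
    Summable fun x : Fin d → ℤ => (bracket x)⁻¹ ^ (d + 1) := by
  refine Summable.of_norm_bounded_eventually (summable_norm_inv_pow d) ?_
  filter_upwards [(Set.finite_singleton (0 : Fin d → ℤ)).compl_mem_cofinite] with x h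
  have h0 : 0 < ‖x‖ := norm_pos_iff.2 h
  have h1 := bracket_pos x
  rw [Real.norm_of_nonneg (by positivity)]
  gcongr
  exact le_add_of_nonneg_left zero_le_one

theorem norm_le_latticeNorm (q : Fin d → ℤ) : ‖q‖ ≤ latticeNorm q := by
  refine (pi_norm_le_iff_of_nonneg (Real.sqrt_nonneg _)).2 fun i => Real.le_sqrt_of_sq_le ?_
  rw [Int.norm_eq_abs, sq_abs]
  exact Finset.single_le_sum (f := fun i => (q i : ℝ) ^ 2) (fun i _ => sq_nonneg _)
    (Finset.mem_univ i)

/-- Exponential decay beats every polynomial weight. -/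
theorem exists_bracket_pow_mul_le (d m : ℕ) {α : ℝ} (h0 : 0 < α) (h1 : α < 1) :
    ∃ C, ∀ q : Fin d → ℤ, bracket q ^ m * α ^ latticeNorm q ≤ C := by
  have hb : 0 < -Real.log α := neg_pos.2 (Real.log_neg h0 h1)
  set b := -Real.log α with hbdef
  refine ⟨(m.factorial : ℝ) / b ^ m * Real.exp b, fun q => ?_⟩
  have hq : bracket q ≤ 1 + latticeNorm q := by
    rw [bracket]; linarith [norm_le_latticeNorm q]
  have hpos := (bracket_pos q).trans_le hq
  have e : α ^ latticeNorm q = Real.exp b * Real.exp (-(b * (1 + latticeNorm q))) := by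
    rw [Real.rpow_def_of_pos h0, ← Real.exp_add]
    congr 1
    rw [hbdef]; ring
  -- With `t = 1 + |q|` and `b = -log α`, the bound is `(b t)^m / m! ≤ exp (b t)`.
  have h2 := Real.pow_div_factorial_le_exp (b * (1 + latticeNorm q)) (by positivity) m
  rw [div_le_iff₀ (by positivity), mul_pow] at h2
  have h3 : (1 + latticeNorm q) ^ m ≤
      (m.factorial : ℝ) / b ^ m * Real.exp (b * (1 + latticeNorm q)) := by
    rw [div_mul_eq_mul_div, le_div_iff₀ (by positivity)]
    linarith
  calc bracket q ^ m * α ^ latticeNorm q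
      ≤ ((m.factorial : ℝ) / b ^ m * Real.exp (b * (1 + latticeNorm q))) *
          α ^ latticeNorm q := by
        have := (pow_le_pow_left₀ (bracket_pos q).le hq m).trans h3
        gcongr
    _ = (m.factorial : ℝ) / b ^ m * Real.exp b := by
        have hexp : Real.exp (b * (1 + latticeNorm q)) *
            Real.exp (-(b * (1 + latticeNorm q))) = 1 := by
          rw [← Real.exp_add, add_neg_cancel, Real.exp_zero]
        rw [e]
        linear_combination (m.factorial : ℝ) / b ^ m * Real.exp b * hexp

/-- The direction field varies slowly at infinity:
`⟨x⟩ |u_x - u_y| ≤ C ⟨x - y⟩`. -/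
theorem exists_direction_sub_le (w x₀ : EuclideanSpace ℝ (Fin d)) :
    ∃ C, ∀ x y, bracket x * ‖direction w x₀ x - direction w x₀ y‖ ≤ C * bracket (x - y) := by
  have hM : ∃ M : ℝ, 1 ≤ M ∧ ∀ x, ‖direction w x₀ x‖ ≤ M := by
    refine ⟨max ‖w‖ 1, le_max_right _ _, fun x => ?_⟩
    rw [direction]
    split_ifs with h
    · exact le_max_left _ _
    · refine le_trans (le_of_eq ?_) (le_max_right _ _)
      rw [norm_smul, norm_inv, norm_norm, inv_mul_cancel₀ (norm_ne_zero_iff.2 h)]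
  obtain ⟨M, hM1, hM⟩ := hM
  have key : ∀ x y, ‖translate x₀ x‖ * ‖direction w x₀ x - direction w x₀ y‖ ≤
      2 * M * ‖translate x₀ x - translate x₀ y‖ := by
    intro x y
    have hd : ‖direction w x₀ x - direction w x₀ y‖ ≤ 2 * M := by
      linarith [norm_sub_le (direction w x₀ x) (direction w x₀ y), hM x, hM y]
    -- At a singular point only the boundedness of the field is available, and it suffices.
    by_cases hx : translate x₀ x = 0
    · rw [hx, norm_zero, zero_mul]; positivity
    by_cases hy : translate x₀ y = 0
    · rw [hy, sub_zero, mul_comm]; gcongr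
    have hy' := norm_ne_zero_iff.2 hy
    have hx' := norm_ne_zero_iff.2 hx
    -- For nonzero `u`, `v`: `|u| (u/|u| - v/|v|) = (u - v) + (|v| - |u|) v/|v|`.
    have e : ‖translate x₀ x‖ • (direction w x₀ x - direction w x₀ y) =
        (translate x₀ x - translate x₀ y) +
          ((‖translate x₀ y‖ - ‖translate x₀ x‖) * ‖translate x₀ y‖⁻¹) • translate x₀ y := by
      rw [direction, direction, if_neg hx, if_neg hy, smul_sub, smul_smul, smul_smul,
        mul_inv_cancel₀ hx', one_smul, sub_mul, mul_inv_cancel₀ hy', sub_smul, one_smul]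
      abel
    have e2 : ‖translate x₀ x‖ * ‖direction w x₀ x - direction w x₀ y‖ =
        ‖‖translate x₀ x‖ • (direction w x₀ x - direction w x₀ y)‖ := by
      rw [norm_smul, norm_norm]
    have h3 : ‖((‖translate x₀ y‖ - ‖translate x₀ x‖) * ‖translate x₀ y‖⁻¹) • translate x₀ y‖ ≤
        ‖translate x₀ x - translate x₀ y‖ := by
      rw [norm_smul, norm_mul, norm_inv, norm_norm, mul_assoc, inv_mul_cancel₀ hy', mul_one,
        Real.norm_eq_abs, abs_sub_comm]
      exact abs_norm_sub_norm_le _ _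
    rw [e2, e]
    refine (norm_add_le _ _).trans ?_
    nlinarith [norm_nonneg (translate x₀ x - translate x₀ y)]
  have hlow : ∀ x, ‖x‖ ≤ ‖translate x₀ x‖ + ‖x₀‖ := fun x => by
    refine (pi_norm_le_iff_of_nonneg (by positivity)).2 fun i => ?_
    have h1 := PiLp.norm_apply_le (translate x₀ x) i
    have h2 := PiLp.norm_apply_le x₀ i
    have h3 : ((x i : ℤ) : ℝ) = translate x₀ x i - x₀ i := by simp [translate]
    rw [← Int.norm_cast_real, h3]
    exact (norm_sub_le _ _).trans (add_le_add h1 h2)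
  have hup : ∀ x y, ‖translate x₀ x - translate x₀ y‖ ≤ d * ‖x - y‖ := fun x y => by
    rw [EuclideanSpace.norm_eq]
    have : ∀ i, ‖(translate x₀ x - translate x₀ y) i‖ ^ 2 ≤ ‖x - y‖ ^ 2 := fun i => by
      have h1 := norm_le_pi_norm (x - y) i
      have h3 : (translate x₀ x - translate x₀ y) i = (((x - y) i : ℤ) : ℝ) := by
        simp [translate]
      rw [h3, Int.norm_cast_real]
      gcongr
    refine (Real.sqrt_le_sqrt (Finset.sum_le_sum fun i _ => this i)).trans ?_
    rw [Finset.sum_const, Finset.card_univ, Fintype.card_fin, nsmul_eq_mul]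
    refine Real.sqrt_le_iff.2 ⟨by positivity, ?_⟩
    rw [mul_pow]
    gcongr
    exact_mod_cast Nat.le_self_pow two_ne_zero d
  refine ⟨2 * M * (1 + ‖x₀‖ + d), fun x y => ?_⟩
  have h1 : ‖direction w x₀ x - direction w x₀ y‖ ≤ 2 * M := by
    linarith [norm_sub_le (direction w x₀ x) (direction w x₀ y), hM x, hM y]
  have h2 := key x y
  have h3 := hup x y
  have h4 : bracket x ≤ (1 + ‖x₀‖) + ‖translate x₀ x‖ := by
    have := hlow x
    rw [bracket]; linarith
  calc bracket x * ‖direction w x₀ x - direction w x₀ y‖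
      ≤ ((1 + ‖x₀‖) + ‖translate x₀ x‖) * ‖direction w x₀ x - direction w x₀ y‖ := by gcongr
    _ ≤ (1 + ‖x₀‖) * (2 * M) + 2 * M * (d * ‖x - y‖) := by
        rw [add_mul]
        refine add_le_add (by gcongr) (h2.trans (by gcongr))
    _ ≤ 2 * M * (1 + ‖x₀‖ + d) * bracket (x - y) := by
        have := norm_nonneg (x - y)
        have h5 := norm_nonneg x₀
        have h6 : (0 : ℝ) ≤ d := d.cast_nonneg
        have h7 : 0 ≤ 2 * M * ((1 + ‖x₀‖) * ‖x - y‖ + d) := by positivity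
        rw [bracket]
        linarith

end Weight

/-! ### Operators of negative order -/

section Decay

variable {A : Type*} [CStarAlgebra A] {d : ℕ}

variable (A d) in
/-- The operators of order `-k`: their matrix entries satisfy
`‖T_xy‖ ≤ C_m ⟨x - y⟩^{-m} ⟨x⟩^{-k}` for every `m`. -/
def decayModule (k : ℕ) : Submodule ℂ (MultAlg A (Fin d → ℤ)) where
  carrier := {T | ∀ m : ℕ, ∃ C, ∀ x y,
    bracket (x - y) ^ m * bracket x ^ k * ‖entry T x y‖ ≤ C}
  zero_mem' m := ⟨0, fun x y => by rw [entry_zero, norm_zero, mul_zero]⟩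
  add_mem' := by
    intro T S hT hS m
    obtain ⟨C, hC⟩ := hT m
    obtain ⟨C', hC'⟩ := hS m
    refine ⟨C + C', fun x y => ?_⟩
    have h1 := bracket_pos x
    have h2 := bracket_pos (x - y)
    refine le_trans ?_ (add_le_add (hC x y) (hC' x y))
    rw [entry_add, ← mul_add]
    gcongr
    exact norm_add_le _ _
  smul_mem' := by
    intro c T hT m
    obtain ⟨C, hC⟩ := hT m
    refine ⟨‖c‖ * C, fun x y => ?_⟩
    rw [entry_smul, norm_smul, mul_left_comm]
    exact mul_le_mul_of_nonneg_left (hC x y) (norm_nonneg c)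

theorem norm_one_le : ‖(1 : A)‖ ≤ 1 := by
  rcases subsingleton_or_nontrivial A with h | h
  · rw [Subsingleton.elim (1 : A) 0, norm_zero]; exact zero_le_one
  · exact CStarRing.norm_one.le

theorem one_mem_decayModule : (1 : MultAlg A (Fin d → ℤ)) ∈ decayModule A d 0 := by
  intro m
  refine ⟨1, fun x y => ?_⟩
  change bracket (x - y) ^ m * bracket x ^ 0 * ‖StdModule.single y (1 : A) x‖ ≤ 1
  by_cases h : x = y
  · rw [h, StdModule.single_same, sub_self, bracket, norm_zero, add_zero, one_pow, pow_zero,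
      one_mul, one_mul]
    exact norm_one_le
  · rw [StdModule.single_ne h, norm_zero, mul_zero]; exact zero_le_one

theorem decayModule_antitone {k l : ℕ} (h : k ≤ l) : decayModule A d l ≤ decayModule A d k := by
  intro T hT m
  obtain ⟨C, hC⟩ := hT m
  refine ⟨C, fun x y => le_trans ?_ (hC x y)⟩
  have h2 := bracket_pos (x - y)
  gcongr
  exact one_le_bracket x

/-- Orders add under multiplication. The weight `⟨x⟩^l` is moved past the first factor with
`⟨x⟩ ≤ ⟨x - y⟩ ⟨y⟩`, at the cost of `l` powers of off-diagonal decay; `d + 1` further powers make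
the sum over the intermediate point converge. -/
theorem mul_mem_decayModule {k l : ℕ} {T S : MultAlg A (Fin d → ℤ)} (hT : T ∈ decayModule A d k)
    (hS : S ∈ decayModule A d l) : T * S ∈ decayModule A d (k + l) := by
  intro m
  obtain ⟨C, hC⟩ := hT (m + l + (d + 1))
  obtain ⟨C', hC'⟩ := hS m
  refine ⟨C * C' * ∑' y : Fin d → ℤ, (bracket y)⁻¹ ^ (d + 1), fun x z => ?_⟩
  have hsum : HasSum (fun y => (bracket (x - y))⁻¹ ^ (d + 1))
      (∑' y : Fin d → ℤ, (bracket y)⁻¹ ^ (d + 1)) :=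
    (Equiv.subLeft x).hasSum_iff.2 (summable_bracket_inv_pow d).hasSum
  have hpos : 0 < bracket (x - z) ^ m * bracket x ^ (k + l) :=
    mul_pos (pow_pos (bracket_pos _) _) (pow_pos (bracket_pos _) _)
  rw [mul_comm, ← le_div_iff₀ hpos, mul_div_right_comm]
  refine (hasSum_entry_mul_entry T S x z).norm_le_of_bounded (hsum.mul_left _) fun y => ?_
  rw [div_mul_eq_mul_div, le_div_iff₀ hpos, mul_comm]
  have hxy := bracket_pos (x - y)
  have hyz := bracket_pos (y - z)
  have hx := bracket_pos x
  have hy := bracket_pos y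
  have h1 : bracket (x - z) ≤ bracket (x - y) * bracket (y - z) := by
    simpa using bracket_add_le (x - y) (y - z)
  have h2 : bracket x ≤ bracket (x - y) * bracket y := by
    simpa using bracket_add_le (x - y) y
  calc bracket (x - z) ^ m * bracket x ^ (k + l) * ‖entry T x y * entry S y z‖
      ≤ (bracket (x - y) * bracket (y - z)) ^ m *
          (bracket x ^ k * (bracket (x - y) * bracket y) ^ l) *
          (‖entry T x y‖ * ‖entry S y z‖) := by
        have h3 := bracket_pos (x - z)
        rw [pow_add (bracket x)]
        gcongr
        exact norm_mul_le _ _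
    _ = (bracket (x - y) ^ (m + l + (d + 1)) * bracket x ^ k * ‖entry T x y‖) *
          (bracket (y - z) ^ m * bracket y ^ l * ‖entry S y z‖) *
          (bracket (x - y))⁻¹ ^ (d + 1) := by
        rw [inv_pow]
        field_simp
        ring
    _ ≤ C * C' * (bracket (x - y))⁻¹ ^ (d + 1) := by
        have h4 : 0 ≤ C := le_trans (by positivity) (hC x y)
        gcongr
        · exact hC x y
        · exact hC' y z

end Decay

/-! ### The trace-class criterion -/

section Trace

variable {A : Type*} [CStarAlgebra A] {d : ℕ} {ξ : LatticeAction d A}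

/-- Hilbert–Schmidt criterion: `∑_x τ((S^* S)_xx) ≤ ‖τ‖ ∑_{x,y} ‖S_yx‖²`. -/
theorem InvariantTrace.extended_star_mul_self_lt_top (τ : InvariantTrace ξ)
    (S : MultAlg A (Fin d → ℤ)) (h : Summable fun z : (Fin d → ℤ) × (Fin d → ℤ) =>
      ‖entry S z.2 z.1‖ ^ 2) : τ.extended (star S * S) < ⊤ := by
  have hb : ∀ x, ‖entry (star S * S) x x‖ ≤ ∑' y, ‖entry S y x‖ ^ 2 := fun x => by
    refine (hasSum_entry_mul_entry (star S) S x x).norm_le_of_bounded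
      (h.prod_factor x).hasSum fun y => ?_
    rw [entry_star, CStarRing.norm_star_mul_self, sq]
  refine lt_of_le_of_lt (ENNReal.tsum_le_tsum fun x => ENNReal.ofReal_le_ofReal ?_)
    (h.prod.mul_left ‖τ.toCLM‖).tsum_ofReal_lt_top
  exact (Complex.re_le_norm _).trans ((τ.toCLM.le_opNorm _).trans
    (mul_le_mul_of_nonneg_left (hb x) (norm_nonneg _)))

/-- `⟨x⟩^{-(d+1)/2}`: square summable on the lattice. -/
def halfWeight (x : Fin d → ℤ) : ℝ := √((bracket x)⁻¹ ^ (d + 1))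

theorem halfWeight_pos (x : Fin d → ℤ) : 0 < halfWeight x :=
  Real.sqrt_pos.2 (pow_pos (inv_pos.2 (bracket_pos x)) _)

theorem halfWeight_mul_self (x : Fin d → ℤ) :
    halfWeight x * halfWeight x = (bracket x)⁻¹ ^ (d + 1) :=
  Real.mul_self_sqrt (pow_nonneg (inv_nonneg.2 (bracket_pos x).le) _)

theorem bracket_inv_pow_le_one (x : Fin d → ℤ) (k : ℕ) : (bracket x)⁻¹ ^ k ≤ 1 :=
  pow_le_one₀ (inv_nonneg.2 (bracket_pos x).le) (inv_le_one_of_one_le₀ (one_le_bracket x))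

theorem halfWeight_le_one (x : Fin d → ℤ) : halfWeight x ≤ 1 :=
  Real.sqrt_le_one.2 (bracket_inv_pow_le_one x _)

theorem tendsto_halfWeight : Tendsto (halfWeight (d := d)) cofinite (𝓝 0) := by
  have h := (summable_bracket_inv_pow d).tendsto_cofinite_zero.sqrt
  rwa [Real.sqrt_zero] at h

/-- The bound makes `S` both square summable and a norm limit of finite matrices. -/
theorem InvariantTrace.star_mul_self_mem_traceClass (τ : InvariantTrace ξ)
    (S : MultAlg A (Fin d → ℤ)) (C : ℝ)
    (h : ∀ x y, ‖entry S x y‖ ≤ C * (bracket (x - y))⁻¹ ^ (d + 1) * halfWeight x) :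
    star S * S ∈ τ.traceClass := by
  have hw := summable_bracket_inv_pow d
  have hC : 0 ≤ C := by
    have h1 := (norm_nonneg _).trans (h 0 0)
    have h2 := halfWeight_pos (0 : Fin d → ℤ)
    have h3 : 0 < (bracket ((0 : Fin d → ℤ) - 0))⁻¹ ^ (d + 1) :=
      pow_pos (inv_pos.2 (bracket_pos _)) _
    by_contra! hneg
    exact absurd h1 (not_le.2 (mul_neg_of_neg_of_pos (mul_neg_of_neg_of_pos hneg h3) h2))
  have hinv : ∀ x : Fin d → ℤ, 0 ≤ (bracket x)⁻¹ ^ (d + 1) := fun x =>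
    pow_nonneg (inv_nonneg.2 (bracket_pos x).le) _
  refine Submodule.subset_span ⟨⟨S, mem_tensorB_of_norm_entry_le S _ _ (hw.mul_left C)
    tendsto_halfWeight halfWeight_le_one (fun x => mul_nonneg hC (hinv x)) h, rfl⟩,
    τ.extended_star_mul_self_lt_top S ?_⟩
  have hprod : Summable fun z : (Fin d → ℤ) × (Fin d → ℤ) =>
      (bracket z.1)⁻¹ ^ (d + 1) * (bracket z.2)⁻¹ ^ (d + 1) :=
    hw.mul_of_nonneg hw hinv hinv
  -- The pair `(x, y)` contributes at most `⟨y - x⟩^{-(d+1)} ⟨y⟩^{-(d+1)}`: use the variables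
  -- `(y - x, y)`.
  have hinj : Function.Injective fun z : (Fin d → ℤ) × (Fin d → ℤ) => (z.2 - z.1, z.2) := by
    rintro ⟨x, y⟩ ⟨x', y'⟩ hz
    obtain ⟨h1, h2⟩ := Prod.mk.inj hz
    dsimp only at h1 h2
    subst h2
    rw [sub_right_injective h1]
  refine Summable.of_nonneg_of_le (fun _ => sq_nonneg _) (fun z => ?_)
    ((hprod.comp_injective hinj).mul_left (C ^ 2))
  have h1 := hinv (z.2 - z.1)
  calc ‖entry S z.2 z.1‖ ^ 2
      ≤ (C * (bracket (z.2 - z.1))⁻¹ ^ (d + 1) * halfWeight z.2) ^ 2 :=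
        pow_le_pow_left₀ (norm_nonneg _) (h _ _) 2
    _ = C ^ 2 * ((bracket (z.2 - z.1))⁻¹ ^ (d + 1) *
          ((bracket (z.2 - z.1))⁻¹ ^ (d + 1) * (halfWeight z.2 * halfWeight z.2))) := by ring
    _ ≤ C ^ 2 * (1 * ((bracket (z.2 - z.1))⁻¹ ^ (d + 1) * (bracket z.2)⁻¹ ^ (d + 1))) := by
        rw [halfWeight_mul_self]
        have h2 := hinv z.2
        gcongr
        exact bracket_inv_pow_le_one _ _
    _ = _ := by rw [one_mul]; rfl

/-- Polarization: if `J` contains all `(P + zR)^* (P + zR)`, then it contains `P^* R`. -/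
theorem star_mul_mem_of_forall_star_mul_self_mem {B : Type*} [Ring B] [StarRing B] [Algebra ℂ B]
    [StarModule ℂ B] (J : Submodule ℂ B) (P R : B)
    (h : ∀ z : ℂ, star (P + z • R) * (P + z • R) ∈ J) : star P * R ∈ J := by
  have e : star P * R = (1 / 4 : ℂ) • (star (P + (1 : ℂ) • R) * (P + (1 : ℂ) • R)
      - star (P + (-1 : ℂ) • R) * (P + (-1 : ℂ) • R)
      - Complex.I • (star (P + Complex.I • R) * (P + Complex.I • R))
      + Complex.I • (star (P + (-Complex.I) • R) * (P + (-Complex.I) • R))) := by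
    simp only [star_add, star_smul, mul_add, add_mul, smul_mul_assoc, mul_smul_comm, smul_add,
      smul_sub, smul_smul, Complex.star_def, map_neg, map_one, Complex.conj_I]
    match_scalars <;> ring_nf <;> norm_num [Complex.I_sq]
  rw [e]
  exact J.smul_mem _ (J.add_mem (J.sub_mem (J.sub_mem (h _) (h _)) (J.smul_mem _ (h _)))
    (J.smul_mem _ (h _)))

/-- Operators of order `-(d+1)` are of trace class: they factor as `P R` with
`P = ∑_x ⟨x⟩^{-(d+1)/2} ⊗ E_xx`, both factors being Hilbert–Schmidt. -/
theorem InvariantTrace.decayModule_le_traceClass (τ : InvariantTrace ξ) :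
    decayModule A d (d + 1) ≤ τ.traceClass := by
  intro T hT
  obtain ⟨C, hC⟩ := hT (d + 1)
  have hp : ∃ B, ∀ x : Fin d → ℤ, ‖((halfWeight x : ℝ) : ℂ) • (1 : A)‖ ≤ B := ⟨1, fun x => by
    rw [norm_smul, Complex.norm_real, Real.norm_of_nonneg (halfWeight_pos x).le]
    exact mul_le_one₀ (halfWeight_le_one x) (norm_nonneg _) norm_one_le⟩
  let P : MultAlg A (Fin d → ℤ) := diag _ hp
  have hK : ∀ x y, ‖((halfWeight x : ℝ) : ℂ)⁻¹ • entry T x y‖ ≤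
      C * (bracket (x - y))⁻¹ ^ (d + 1) * halfWeight x := fun x y => by
    have h1 := bracket_pos x
    have h2 := bracket_pos (x - y)
    have h3 := halfWeight_pos x
    rw [norm_smul, norm_inv, Complex.norm_real, Real.norm_of_nonneg h3.le,
      inv_mul_le_iff₀ h3, mul_left_comm, mul_assoc, ← mul_assoc, ← mul_assoc]
    have h4 := halfWeight_mul_self x
    calc ‖entry T x y‖ = (bracket (x - y) ^ (d + 1) * bracket x ^ (d + 1) * ‖entry T x y‖) *
          ((bracket (x - y))⁻¹ ^ (d + 1) * (bracket x)⁻¹ ^ (d + 1)) := by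
          rw [inv_pow, inv_pow]
          field_simp
      _ ≤ C * ((bracket (x - y))⁻¹ ^ (d + 1) * (bracket x)⁻¹ ^ (d + 1)) := by
          gcongr
          exact hC x y
      _ = _ := by rw [← h4]; ring
  have hC0 : 0 ≤ C := le_trans (by
    have := bracket_pos (0 : Fin d → ℤ)
    have := bracket_pos ((0 : Fin d → ℤ) - 0)
    positivity) (hC 0 0)
  obtain ⟨R, hR, -⟩ := exists_hasSum_diag_mul_shift
    (fun x y => ((halfWeight x : ℝ) : ℂ)⁻¹ • entry T x y) _
    ((summable_bracket_inv_pow d).mul_left C) fun x y => (hK x y).trans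
      (mul_le_of_le_one_right
        (mul_nonneg hC0 (pow_nonneg (inv_nonneg.2 (bracket_pos _).le) _)) (halfWeight_le_one x))
  have hP : star P = P := by
    rw [star_diag _ _ (by simpa only [norm_star] using hp)]
    refine ext_apply fun v x => ?_
    simp [P]
  have hTPR : T = star P * R := by
    rw [hP]
    refine ext_entry fun x y => ?_
    have : ((halfWeight x : ℝ) : ℂ) ≠ 0 := Complex.ofReal_ne_zero.2 (halfWeight_pos x).ne'
    rw [entry_diag_mul, hR, smul_mul_assoc, one_mul, smul_smul, mul_inv_cancel₀ this, one_smul]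
  rw [hTPR]
  refine star_mul_mem_of_forall_star_mul_self_mem _ _ _ fun z =>
    τ.star_mul_self_mem_traceClass _ (1 + ‖z‖ * C) fun x y => ?_
  rw [entry_add, entry_smul, hR, add_mul, add_mul, one_mul, mul_assoc ‖z‖, mul_assoc ‖z‖]
  refine (norm_add_le _ _).trans (add_le_add ?_ ?_)
  · classical
    rw [entry_diag]
    split_ifs with h
    · subst h
      rw [sub_self, bracket, norm_zero, add_zero, inv_one, one_pow, one_mul, norm_smul,
        Complex.norm_real, Real.norm_of_nonneg (halfWeight_pos x).le]
      exact mul_le_of_le_one_right (halfWeight_pos x).le norm_one_le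
    · rw [norm_zero]
      exact mul_nonneg (pow_nonneg (inv_nonneg.2 (bracket_pos _).le) _) (halfWeight_pos x).le
  · rw [norm_smul]
    exact mul_le_mul_of_nonneg_left (hK x y) (norm_nonneg z)

end Trace

/-! ### Commutators with the phase -/

section Commutator

variable {A : Type*} [CStarAlgebra A] {d : ℕ}

/-- The commutator of a component of the phase with an element of the local algebra has order
`-1`: its entries are `(u_x - u_y) ξ_x(Φ_{x-y}(a))`. -/
theorem commutator_mem_decayModule (ξ : LatticeAction d A) (w x₀ : EuclideanSpace ℝ (Fin d))
    (i : Fin d) {a : CrossedProduct ξ} (ha : a ∈ locAlgebra ξ) :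
    diag (fun x => ((direction w x₀ x i : ℝ) : ℂ) • (1 : A)) (direction_bdd w x₀ i) * rep ξ a -
      rep ξ a * diag (fun x => ((direction w x₀ x i : ℝ) : ℂ) • (1 : A)) (direction_bdd w x₀ i) ∈
      decayModule A d 1 := by
  intro m
  obtain ⟨α, h0, h1, B, hB⟩ := ha
  obtain ⟨C, hC⟩ := exists_direction_sub_le w x₀
  obtain ⟨C', hC'⟩ := exists_bracket_pow_mul_le d (m + 1) h0 h1
  have hΦ : ∀ q, ‖fourier ξ q a‖ ≤ B * α ^ latticeNorm q := fun q => by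
    have h2 : α ^ (-latticeNorm q) * ‖fourier ξ q a‖ ≤ B := hB ⟨q, rfl⟩
    rw [Real.rpow_neg h0.le, inv_mul_le_iff₀ (Real.rpow_pos_of_pos h0 _)] at h2
    linarith
  have hB0 : 0 ≤ B := le_trans (mul_nonneg (Real.rpow_nonneg h0.le _) (norm_nonneg _)) (hB ⟨0, rfl⟩)
  have hC0 : 0 ≤ C := nonneg_of_mul_nonneg_left
    (le_trans (mul_nonneg (bracket_pos _).le (norm_nonneg _)) (hC 0 0)) (bracket_pos _)
  refine ⟨C * B * C', fun x y => ?_⟩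
  have hb := bracket_pos x
  have hb' := bracket_pos (x - y)
  have hα := Real.rpow_nonneg h0.le (latticeNorm (x - y))
  rw [entry_sub, entry_diag_mul, entry_mul_diag, smul_mul_assoc, one_mul, mul_smul_comm, mul_one,
    ← sub_smul, norm_smul, entry_rep, ξ.norm_aut, ← Complex.ofReal_sub, Complex.norm_real, pow_one]
  have hd : ‖direction w x₀ x i - direction w x₀ y i‖ ≤
      ‖direction w x₀ x - direction w x₀ y‖ :=
    PiLp.norm_apply_le (direction w x₀ x - direction w x₀ y) i
  calc _ ≤ bracket (x - y) ^ m * bracket x *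
        (‖direction w x₀ x - direction w x₀ y‖ * (B * α ^ latticeNorm (x - y))) := by
        gcongr
        exact hΦ _
    _ = bracket (x - y) ^ m * (bracket x * ‖direction w x₀ x - direction w x₀ y‖) *
        (B * α ^ latticeNorm (x - y)) := by ring
    _ ≤ bracket (x - y) ^ m * (C * bracket (x - y)) * (B * α ^ latticeNorm (x - y)) :=
        mul_le_mul_of_nonneg_right
          (mul_le_mul_of_nonneg_left (hC x y) (pow_nonneg hb'.le m)) (mul_nonneg hB0 hα)
    _ = C * B * (bracket (x - y) ^ (m + 1) * α ^ latticeNorm (x - y)) := by ring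
    _ ≤ C * B * C' := by
        gcongr
        exact hC' _

end Commutator

/-! ### Tensoring with the Clifford algebra -/

section Clifford

open TensorProduct

variable {A : Type*} [CStarAlgebra A] {d : ℕ}

variable (A d) in
/-- `Cl_d ⊗ 𝒟` for the operators `𝒟` of order `-k`. -/
def cliffordDecay (k : ℕ) : Submodule ℂ (Cl d ⊗[ℂ] MultAlg A (Fin d → ℤ)) :=
  LinearMap.range (LinearMap.lTensor (Cl d) (decayModule A d k).subtype)

theorem tmul_mem_range_lTensor {M N : Type*} [AddCommGroup M] [Module ℂ M] [AddCommGroup N]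
    [Module ℂ N] {S : Submodule ℂ N} (c : M) {T : N} (hT : T ∈ S) :
    c ⊗ₜ[ℂ] T ∈ LinearMap.range (LinearMap.lTensor M S.subtype) :=
  ⟨c ⊗ₜ ⟨T, hT⟩, rfl⟩

theorem range_lTensor_mono {M N : Type*} [AddCommGroup M] [Module ℂ M] [AddCommGroup N]
    [Module ℂ N] {S S' : Submodule ℂ N} (h : S ≤ S') :
    LinearMap.range (LinearMap.lTensor M S.subtype) ≤
      LinearMap.range (LinearMap.lTensor M S'.subtype) := by
  rintro _ ⟨t, rfl⟩
  induction t with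
  | zero => rw [map_zero]; exact zero_mem _
  | tmul c T => exact tmul_mem_range_lTensor c (h T.2)
  | add s t hs ht => rw [map_add]; exact add_mem hs ht

theorem mul_mem_cliffordDecay {k l : ℕ} {s t : Cl d ⊗[ℂ] MultAlg A (Fin d → ℤ)}
    (hs : s ∈ cliffordDecay A d k) (ht : t ∈ cliffordDecay A d l) :
    s * t ∈ cliffordDecay A d (k + l) := by
  obtain ⟨s, rfl⟩ := hs
  obtain ⟨t, rfl⟩ := ht
  induction s with
  | zero => rw [map_zero, zero_mul]; exact zero_mem _
  | tmul c T =>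
    induction t with
    | zero => rw [map_zero, mul_zero]; exact zero_mem _
    | tmul c' S =>
      rw [LinearMap.lTensor_tmul, LinearMap.lTensor_tmul, Algebra.TensorProduct.tmul_mul_tmul]
      exact tmul_mem_range_lTensor _ (mul_mem_decayModule T.2 S.2)
    | add s t hs ht => rw [map_add, mul_add]; exact add_mem hs ht
  | add s t hs ht => rw [map_add, add_mul]; exact add_mem hs ht

theorem list_prod_mem_cliffordDecay (L : List (Cl d ⊗[ℂ] MultAlg A (Fin d → ℤ)))
    (h : ∀ t ∈ L, t ∈ cliffordDecay A d 1) : L.prod ∈ cliffordDecay A d L.length := by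
  induction L with
  | nil => exact tmul_mem_range_lTensor 1 one_mem_decayModule
  | cons t L ih =>
    rw [List.prod_cons, List.length_cons, add_comm]
    exact mul_mem_cliffordDecay (h t List.mem_cons_self)
      (ih fun s hs => h s (List.mem_cons_of_mem t hs))

theorem commutator_phase_mem_cliffordDecay (ξ : LatticeAction d A)
    (w : EuclideanSpace ℝ (Fin d)) (x₀ : unitCube d) {a : CrossedProduct ξ}
    (ha : a ∈ locAlgebra ξ) :
    (intrinsicFamily ξ w x₀).phase * (intrinsicFamily ξ w x₀).rep a -
      (intrinsicFamily ξ w x₀).rep a * (intrinsicFamily ξ w x₀).phase ∈ cliffordDecay A d 1 := by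
  change diracPhase A w x₀ * (1 ⊗ₜ[ℂ] rep ξ a) - (1 ⊗ₜ[ℂ] rep ξ a) * diracPhase A w x₀ ∈ _
  rw [diracPhase, Finset.sum_mul, Finset.mul_sum, ← Finset.sum_sub_distrib]
  refine Submodule.sum_mem _ fun i _ => ?_
  rw [Algebra.TensorProduct.tmul_mul_tmul, Algebra.TensorProduct.tmul_mul_tmul, mul_one, one_mul,
    ← tmul_sub]
  exact tmul_mem_range_lTensor _ (commutator_mem_decayModule ξ w x₀ i ha)

end Clifford

end Intrinsic

end


theorem mainTheorem5 {A : Type*} [CStarAlgebra A] [TopologicalSpace.SeparableSpace A]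
    {d : ℕ} (hd : Even d) (ξ : Intrinsic.LatticeAction d A) (τ : Intrinsic.InvariantTrace ξ)
    (w : EuclideanSpace ℝ (Fin d)) (hw : ‖w‖ = 1) (n : ℕ) (hn : d + 1 ≤ n) :
    Intrinsic.IsSummableOver (Intrinsic.intrinsicFamily ξ w) n (Intrinsic.locAlgebra ξ)
      τ.cliffordTraceClass := by
  intro x₀ a ha
  refine Intrinsic.range_lTensor_mono
    ((Intrinsic.decayModule_antitone hn).trans τ.decayModule_le_traceClass) ?_
  have h := Intrinsic.list_prod_mem_cliffordDecay (List.ofFn fun i =>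
    (Intrinsic.intrinsicFamily ξ w x₀).phase * (Intrinsic.intrinsicFamily ξ w x₀).rep (a i) -
      (Intrinsic.intrinsicFamily ξ w x₀).rep (a i) * (Intrinsic.intrinsicFamily ξ w x₀).phase)
    fun t ht => by
      obtain ⟨i, rfl⟩ := (List.mem_ofFn' _ _).1 ht
      exact Intrinsic.commutator_phase_mem_cliffordDecay ξ w x₀ (ha i)
  rwa [List.length_ofFn] at h
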